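/- Let $d\ge1$ be an integer, $\gamma>1$ and $\kappa=\frac{\gamma-1}2$. For a polytropic isentropic gas ($p=A\rho^\gamma$, $A>0$) with sound speed $c=\sqrt{p'(\rho)}=\sqrt{\gamma A}\,\rho^{\kappa}\ge0$ and velocity $u$ in $\mathbb R^d$, consider the Cauchy problem for the symmetric form of the Euler system, in terms of $\bar c=c/\kappa$, $$\partial_t\bar c+(u\cdot\nabla)\bar c+\kappa\,\bar c\,\mathrm{div}\,u=0,\qquad \partial_tu+(u\cdot\nabla)u+\kappa\,\bar c\,\nabla\bar c=0,\qquad (c,u)|_{t=0}=(c_0,u_0),$$ with data $(c_0,u_0)\in H^s(\mathbb R^d)$, $s>1+\frac d2$, $c_0\ge0$ (identified with their continuous representatives). Let $T^*$ be the maximal forward time of existence of the smooth solution, that is, the supremum of all $T>0$ such that for some $S>0$ the problem has a solution in the class $C(I;H^s(\mathbb R^d))\cap C^1(I;H^{s-1}(\mathbb R^d))$ on $I=(-S,T)$; by Sobolev embedding such solutions are classical, i.e. $C^1$ on $I\times\mathbb R^d$. Assume that $\gamma\le1+\frac1{d-1}$ (no upper bound on $\gamma$ if $d=1$), that $c_0$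 is not identically zero, and that $c_0$ vanishes outside a bounded open set $\Omega(0)\subset\mathbb R^d$ (for instance, a bounded domain with smooth boundary). If $$J:=\int_{\Omega(0)}\det\nabla u_0(x)\,dx\le0,$$ then $T^*<+\infty$. -/

import Mathlib

open MeasureTheory Set
open scoped ENNReal

noncomputable section

namespace VacuumEuler

/-- The physical space `ℝ^d` with its Euclidean norm. -/
abbrev Space (d : ℕ) : Type := EuclideanSpace ℝ (Fin d)

/-- The real function `f` is square integrable and the `L²` function `g` is its Bessel potential
`(1 + |ξ|²)^(s/2)` (as a Fourier multiplier) of order `s`. For `s ≥ 0` the Sobolev space `H^s(ℝ^d)`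
consists of the classes of those `f` that have such a `g`, and then `‖f‖_{H^s} = ‖g‖_{L²}`. -/
def HasBessel {d : ℕ} (s : ℝ) (f : Space d → ℝ) (g : Lp ℂ 2 (volume : Measure (Space d))) :
    Prop :=
  ∃ hf : MemLp (fun x ↦ (f x : ℂ)) 2 (volume : Measure (Space d)),
    TemperedDistribution.besselPotential (Space d) ℂ s (Lp.toTemperedDistribution hf.toLp) =
      Lp.toTemperedDistribution g

/-- The continuous function `f` belongs to `H^s(ℝ^d)` (for `s > d/2`, every class in `H^s` has
exactly one continuous representative, with which it is identified). -/
def MemHs {d : ℕ} (s : ℝ) (f : Space d → ℝ) : Prop :=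
  Continuous f ∧ ∃ hf : MemLp (fun x ↦ (f x : ℂ)) 2 (volume : Measure (Space d)),
    TemperedDistribution.MemSobolev s 2 (Lp.toTemperedDistribution hf.toLp)

/-- The curve `t ↦ f t` is of class `C^k(I; H^s(ℝ^d))`: the Bessel potential of order `s` is an
isometry of `H^s` onto `L²`, so this says that `t ↦ g t` is of class `C^k` from `I` to `L²`. -/
def MemCkHs {d : ℕ} (k : ℕ) (s : ℝ) (I : Set ℝ) (f : ℝ → Space d → ℝ) : Prop :=
  ∃ g : ℝ → Lp ℂ 2 (volume : Measure (Space d)),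
    ContDiffOn ℝ k g I ∧ ∀ t ∈ I, HasBessel s (f t) (g t)

/-- The divergence of a vector field. -/
def divergence {d : ℕ} (v : Space d → Space d) (x : Space d) : ℝ :=
  ∑ i, fderiv ℝ v x (EuclideanSpace.single i 1) i

/-- The quasi-linear symmetric form of the isentropic Euler system, at every time of `I` and every
point of `ℝ^d`, for the renormalized sound speed `b = c / κ` and the velocity `u`:
`∂ₜ b + (u·∇) b + κ b div u = 0`, `∂ₜ u + (u·∇) u + κ b ∇b = 0`. -/
def SymmetricEuler {d : ℕ} (κ : ℝ) (I : Set ℝ) (b : ℝ → Space d → ℝ)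
    (u : ℝ → Space d → Space d) : Prop :=
  ∀ t ∈ I, ∀ x,
    deriv (fun τ ↦ b τ x) t + fderiv ℝ (b t) x (u t x) + κ * b t x * divergence (u t) x = 0 ∧
    deriv (fun τ ↦ u τ x) t + fderiv ℝ (u t) x (u t x) + (κ * b t x) • gradient (b t) x = 0

/-- `(c, u)` is a solution on the open time interval `I`, `0 ∈ I`, of the Cauchy problem for a
polytropic gas of adiabatic constant `γ` with initial sound speed `c₀` and initial velocity `u₀`,
in the class `C(I; H^s) ∩ C¹(I; H^{s-1})`. For `s > 1 + d/2` such a solution has exactly one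
representative that is `C¹` on `I × ℝ^d`; `(c, u)` stands for that one. -/
structure IsSmoothSolution {d : ℕ} (γ s : ℝ) (I : Set ℝ) (c₀ : Space d → ℝ)
    (u₀ : Space d → Space d) (c : ℝ → Space d → ℝ) (u : ℝ → Space d → Space d) : Prop where
  sound_Hs : MemCkHs 0 s I c
  velocity_Hs : ∀ i, MemCkHs 0 s I (fun t x ↦ u t x i)
  sound_Hs_sub_one : MemCkHs 1 (s - 1) I c
  velocity_Hs_sub_one : ∀ i, MemCkHs 1 (s - 1) I (fun t x ↦ u t x i)
  sound_C1 : ContDiffOn ℝ 1 (fun p : ℝ × Space d ↦ c p.1 p.2) (I ×ˢ univ)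
  velocity_C1 : ContDiffOn ℝ 1 (fun p : ℝ × Space d ↦ u p.1 p.2) (I ×ˢ univ)
  euler : SymmetricEuler ((γ - 1) / 2) I (fun t x ↦ c t x / ((γ - 1) / 2)) u
  sound_init : c 0 = c₀
  velocity_init : u 0 = u₀

/-- The maximal (forward) time of existence `T* ∈ [0, +∞]`: the supremum of all `T > 0` such that a
smooth solution exists on an open time interval `(-S, T)` containing `0`. -/
def maximalTime {d : ℕ} (γ s : ℝ) (c₀ : Space d → ℝ) (u₀ : Space d → Space d) : ℝ≥0∞ :=
  sSup {τ | ∃ S T : ℝ, 0 < S ∧ 0 < T ∧ τ = ENNReal.ofReal T ∧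
    ∃ c u, IsSmoothSolution γ s (Ioo (-S) T) c₀ u₀ c u}

end VacuumEuler

end

namespace VacuumEuler
open Filter Topology
open scoped NNReal

/-! A particle that starts in the vacuum feels no pressure. Along its straight line, u - u₀(x) and c
obey a linear homogeneous differential inequality with zero initial data, so they stay zero
(`ClassicalEuler.vacuum`). Outside Ω the flow is therefore the explicit map x + t u₀(x). Since the
Jacobian determinant is a null Lagrangian (`setIntegral_det_one_add_fderiv_congr`), the gas occupies
at time t the volume V(t) = ∫_Ω det(1 + t∇u₀), a polynomial in t whose coefficient of t^d is J. As J
≤ 0, V(t) ≤ const · t^(d-1) for t ≥ 1.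

Two bounds on the internal energy then conflict. Up to constants, the density is c^(1/κ) and the
internal energy is E = ∫ c^(1/κ) c². On trajectories c = c₀ D^(-κ), with D the Jacobian of the flow,
so E = ∫_Ω c₀^(1/κ) c₀² D^(-2κ). Convexity of D ↦ D^(-2κ) and ∫_Ω D = V give E ≥ const ·
t^(-2κ(d-1)) (`le_integral_mul_rpow_neg`): a confined gas keeps its energy. On the other hand the
gas disperses, E ≤ const · (1+t)^(-min(2, 2κd)) (`ParticleFlow.dispersion`).

Hence t^(min(2, 2κd) - 2κ(d-1)) is bounded in terms of the data. The exponent is positive because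
2κ(d-1) ≤ 1 < 2, so t itself is bounded. Everything is integrated over the fixed set Ω in Lagrangian
coordinates, so the moving boundary needs no regularity. -/

/-! ### Ordinary differential equations. -/

theorem hasDerivWithinAt_Ici_of_Icc {F : Type*} [NormedAddCommGroup F] [NormedSpace ℝ F]
    {α : ℝ → F} {α' : F} {a b t : ℝ} (ht : t ∈ Ico a b)
    (h : HasDerivWithinAt α α' (Icc a b) t) : HasDerivWithinAt α α' (Ici t) t :=
  h.mono_of_mem_nhdsWithin (Icc_mem_nhdsGE_of_mem ht)

/-- A time-dependent vector field that is globally Lipschitz in space has global solutions. -/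
theorem exists_solution_of_lipschitz {F : Type*} [NormedAddCommGroup F] [NormedSpace ℝ F]
    [FiniteDimensional ℝ F] {f : ℝ → F → F} {K : ℝ≥0} {T : ℝ} (hT : 0 ≤ T)
    (hlip : ∀ t ∈ Icc 0 T, LipschitzWith K (f t))
    (hcont : ∀ x, ContinuousOn (fun t ↦ f t x) (Icc 0 T)) (x₀ : F) :
    ∃ α : ℝ → F, α 0 = x₀ ∧ ∀ t ∈ Icc 0 T, HasDerivWithinAt α (f t (α t)) (Icc 0 T) t := by
  have : CompleteSpace F := FiniteDimensional.complete ℝ F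
  obtain ⟨M, hM⟩ := isCompact_Icc.exists_bound_of_continuousOn (hcont 0)
  have hM0 : 0 ≤ M := (norm_nonneg _).trans (hM 0 ⟨le_rfl, hT⟩)
  have hgrow : ∀ t ∈ Icc 0 T, ∀ z, ‖f t z‖ ≤ K * ‖z‖ + M := by
    intro t ht z
    have h1 := (hlip t ht).dist_le_mul z 0
    rw [dist_eq_norm, dist_zero_right] at h1
    have h2 : ‖f t z‖ ≤ ‖f t z - f t 0‖ + ‖f t 0‖ := by
      simpa using norm_add_le (f t z - f t 0) (f t 0)
    linarith [hM t ht]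
  -- The Gronwall bound for every solution on [0, T], plus 1. Truncating the space variable outside
  -- this ball makes the field bounded, so Picard–Lindelöf reaches time T at once; the truncated
  -- solution obeys the same bound and hence never sees the truncation.
  set R : ℝ := gronwallBound ‖x₀‖ K M T + 1 with hR
  have hRpos : 0 < R := by
    have : 0 ≤ gronwallBound ‖x₀‖ K M T := by
      have h := gronwallBound_mono (norm_nonneg x₀) hM0 K.coe_nonneg hT
      rw [gronwallBound_x0] at h
      exact (norm_nonneg _).trans h
    linarith
  let χ : ContDiffBump (0 : F) := ⟨R, 2 * R, hRpos, by linarith⟩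
  set ψ : F → F := fun z ↦ χ z • z with hψ
  have hψsupp : HasCompactSupport ψ := χ.hasCompactSupport.smul_right
  have hψC : ContDiff ℝ 1 ψ := (χ.contDiff (n := 1)).smul contDiff_id
  obtain ⟨Kψ, hKψ⟩ := hψC.lipschitzWith_of_hasCompactSupport hψsupp one_ne_zero
  have hψle : ∀ z, ‖ψ z‖ ≤ ‖z‖ := by
    intro z
    simp only [hψ, norm_smul, Real.norm_eq_abs, abs_of_nonneg χ.nonneg]
    exact mul_le_of_le_one_left (norm_nonneg _) χ.le_one
  obtain ⟨B, hB⟩ := hψC.continuous.bounded_above_of_compact_support hψsupp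
  have hB0 : 0 ≤ B := (norm_nonneg _).trans (hB 0)
  let L : ℝ≥0 := ⟨K * B + M, by positivity⟩
  have hPL : IsPicardLindelof (fun t z ↦ f t (ψ z)) (⟨0, le_rfl, hT⟩ : Icc (0 : ℝ) T) x₀
      (L * ⟨T, hT⟩) 0 L (K * Kψ) := by
    refine ⟨fun t ht ↦ ((hlip t ht).comp hKψ).lipschitzOnWith, fun x _ ↦ hcont _, ?_, ?_⟩
    · intro t ht x _
      refine (hgrow t ht _).trans ?_
      change _ ≤ (K : ℝ) * B + M
      gcongr
      exact hB x
    · simp only [sub_zero, sub_self, NNReal.coe_zero]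
      rw [max_eq_left hT]
      exact le_rfl
  obtain ⟨α, hα0, hα⟩ := hPL.exists_eq_forall_mem_Icc_hasDerivWithinAt₀
  refine ⟨α, hα0, fun t ht ↦ ?_⟩
  have hcα : ContinuousOn α (Icc 0 T) := fun s hs ↦ (hα s hs).continuousWithinAt
  have hbound := norm_le_gronwallBound_of_norm_deriv_right_le (δ := ‖x₀‖) (K := K) (ε := M) hcα
    (fun s hs ↦ hasDerivWithinAt_Ici_of_Icc hs (hα s (Ico_subset_Icc_self hs))) (by
      have : α 0 = x₀ := hα0
      rw [this]) (fun s hs ↦ by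
      refine (hgrow s (Ico_subset_Icc_self hs) _).trans ?_
      gcongr
      exact hψle _) t ht
  have hle : ‖α t‖ ≤ R := by
    have := gronwallBound_mono (norm_nonneg x₀) hM0 K.coe_nonneg (a := t - 0) (b := T) (by linarith [ht.2])
    linarith
  have hψα : ψ (α t) = α t := by
    simp only [hψ]
    rw [χ.one_of_mem_closedBall (by simpa [χ] using hle), one_smul]
  have := hα t ht
  rwa [hψα] at this

/-- Two-point linearization: the flow of a `C¹` compactly supported field is strictly
differentiable, and its derivative solves the variational equation. -/
theorem hasStrictFDerivAt_flow {E : Type*} [NormedAddCommGroup E] [NormedSpace ℝ E]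
    {v : ℝ → E → E} {K : ℝ≥0} {T : ℝ}
    (hdiff : ∀ t, Differentiable ℝ (v t))
    (huc : UniformContinuous (fun p : ℝ × E ↦ fderiv ℝ (v p.1) p.2))
    (hlip : ∀ t, LipschitzWith K (v t))
    {Y : ℝ → E → E} (hY0 : ∀ x, Y 0 x = x)
    (hY : ∀ x, ∀ t ∈ Icc 0 T, HasDerivWithinAt (fun τ ↦ Y τ x) (v t (Y t x)) (Icc 0 T) t)
    {x : E} {Z : ℝ → E →L[ℝ] E} (hZ0 : Z 0 = ContinuousLinearMap.id ℝ E)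
    (hZ : ∀ t ∈ Icc 0 T,
      HasDerivWithinAt Z ((fderiv ℝ (v t) (Y t x)).comp (Z t)) (Icc 0 T) t)
    {t : ℝ} (ht : t ∈ Icc 0 T) : HasStrictFDerivAt (Y t) (Z t) x := by
  have hT : 0 ≤ T := ht.1.trans ht.2
  have hdist : ∀ s ∈ Icc 0 T, ∀ y z, ‖Y s y - Y s z‖ ≤ ‖y - z‖ * Real.exp (K * T) := by
    intro s hs y z
    have := dist_le_of_trajectories_ODE (v := v) (K := K) (a := 0) (b := T) (δ := dist y z)
      hlip
      (fun s hs ↦ (hY y s hs).continuousWithinAt)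
      (fun s hs ↦ hasDerivWithinAt_Ici_of_Icc hs (hY y s (Ico_subset_Icc_self hs)))
      (fun s hs ↦ (hY z s hs).continuousWithinAt)
      (fun s hs ↦ hasDerivWithinAt_Ici_of_Icc hs (hY z s (Ico_subset_Icc_self hs)))
      (by rw [hY0, hY0]) s hs
    rw [dist_eq_norm, dist_eq_norm] at this
    refine this.trans ?_
    gcongr
    linarith [hs.2]
  refine HasStrictFDerivAt.of_isLittleO (Asymptotics.isLittleO_iff.2 fun ε hε ↦ ?_)
  set G : ℝ := gronwallBound 0 K (Real.exp (K * T)) T with hG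
  have hG0 : 0 ≤ G := by
    have h := gronwallBound_mono le_rfl (Real.exp_pos (K * T)).le K.coe_nonneg hT
    rwa [gronwallBound_x0] at h
  -- The remainder will be at most η G ‖y - z‖; dividing by G + 1 also covers G = 0.
  set η : ℝ := ε / (G + 1) with hη
  have hηpos : 0 < η := by positivity
  obtain ⟨δ, hδ, hδ'⟩ := Metric.uniformContinuous_iff.1 huc η hηpos
  have hev : ∀ᶠ y in 𝓝 x, ‖y - x‖ * Real.exp (K * T) < δ := by
    have : Tendsto (fun y ↦ ‖y - x‖ * Real.exp (K * T)) (𝓝 x) (𝓝 (‖x - x‖ * Real.exp (K * T))) :=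
      Continuous.tendsto (by fun_prop) x
    rw [sub_self, norm_zero, zero_mul] at this
    exact this.eventually (gt_mem_nhds hδ)
  have hev2 : ∀ᶠ p : E × E in 𝓝 (x, x), ‖p.1 - x‖ * Real.exp (K * T) < δ ∧
      ‖p.2 - x‖ * Real.exp (K * T) < δ := by
    rw [nhds_prod_eq]
    exact hev.prod_mk hev
  filter_upwards [hev2] with p hp
  obtain ⟨y, z⟩ := p
  obtain ⟨hy, hz⟩ := hp
  -- This two-point remainder solves the linearized equation up to an error η ‖Y s y - Y s z‖, which
  -- is the mean value inequality on a ball where the derivative of v s varies by at most η.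
  -- Comparing two free points y, z, rather than y with x, is what yields strict differentiability.
  have hw : ∀ s ∈ Icc 0 T, HasDerivWithinAt (fun s ↦ Y s y - Y s z - Z s (y - z))
      (v s (Y s y) - v s (Y s z) - (fderiv ℝ (v s) (Y s x)).comp (Z s) (y - z)) (Icc 0 T) s := by
    intro s hs
    exact ((hY y s hs).sub (hY z s hs)).sub ((ContinuousLinearMap.apply ℝ E (y - z)).hasFDerivAt.comp_hasDerivWithinAt s (hZ s hs))
  have hlin : ∀ s ∈ Icc 0 T, ‖v s (Y s y) - v s (Y s z) - fderiv ℝ (v s) (Y s x)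
      (Y s y - Y s z)‖ ≤ η * ‖Y s y - Y s z‖ := by
    intro s hs
    refine (convex_ball (Y s x) δ).norm_image_sub_le_of_norm_fderiv_le' (𝕜 := ℝ)
      (fun q _ ↦ hdiff s q) (fun q hq ↦ ?_) ?_ ?_
    · rw [← dist_eq_norm]
      refine (hδ' (a := (s, q)) (b := (s, Y s x)) ?_).le
      rw [Prod.dist_eq]
      simpa [hδ] using hq
    · rw [mem_ball_iff_norm]
      exact (hdist s hs z x).trans_lt hz
    · rw [mem_ball_iff_norm]
      exact (hdist s hs y x).trans_lt hy
  have hfd : ∀ s q, ‖fderiv ℝ (v s) q‖ ≤ K := fun s q ↦ norm_fderiv_le_of_lipschitz ℝ (hlip s)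
  have key := norm_le_gronwallBound_of_norm_deriv_right_le (δ := 0) (K := K)
    (ε := η * ‖y - z‖ * Real.exp (K * T)) (a := 0) (b := T)
    (fun s hs ↦ (hw s hs).continuousWithinAt)
    (fun s hs ↦ hasDerivWithinAt_Ici_of_Icc hs (hw s (Ico_subset_Icc_self hs)))
    (by simp [hY0, hZ0]) (fun s hs ↦ by
      have hs' := Ico_subset_Icc_self hs
      have e : v s (Y s y) - v s (Y s z) - (fderiv ℝ (v s) (Y s x)).comp (Z s) (y - z) =
          fderiv ℝ (v s) (Y s x) (Y s y - Y s z - Z s (y - z)) +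
          (v s (Y s y) - v s (Y s z) - fderiv ℝ (v s) (Y s x) (Y s y - Y s z)) := by
        simp only [map_sub, ContinuousLinearMap.comp_apply]
        abel
      rw [e]
      refine (norm_add_le _ _).trans (add_le_add ?_ ?_)
      · exact (ContinuousLinearMap.le_opNorm _ _).trans (by gcongr; exact hfd _ _)
      · refine (hlin s hs').trans ?_
        rw [mul_assoc]
        gcongr
        exact hdist s hs' y z) t ht
  refine key.trans ?_
  have hmono := gronwallBound_mono (δ := 0) (ε := η * ‖y - z‖ * Real.exp (K * T)) le_rfl
    (by positivity) K.coe_nonneg (a := t - 0) (b := T) (by linarith [ht.2])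
  refine hmono.trans ?_
  have hscale : gronwallBound 0 K (η * ‖y - z‖ * Real.exp (K * T)) T = η * ‖y - z‖ * G := by
    rw [hG]
    unfold gronwallBound
    split_ifs <;> ring
  change gronwallBound 0 K (η * ‖y - z‖ * Real.exp (K * T)) T ≤ ε * ‖y - z‖
  rw [hscale]
  have : η * G ≤ ε := by
    rw [hη, div_mul_eq_mul_div, div_le_iff₀ (by positivity)]
    nlinarith
  calc η * ‖y - z‖ * G = (η * G) * ‖y - z‖ := by ring
    _ ≤ ε * ‖y - z‖ := by gcongr

/-- The solution of a scalar linear equation `f' = k a f`. -/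
theorem eq_mul_exp_of_hasDerivWithinAt {a f : ℝ → ℝ} {k T : ℝ} (ha : ContinuousOn a (Icc 0 T))
    (hf : ∀ t ∈ Icc 0 T, HasDerivWithinAt f (k * a t * f t) (Icc 0 T) t) {t : ℝ}
    (ht : t ∈ Icc 0 T) : f t = f 0 * Real.exp (k * ∫ s in (0 : ℝ)..t, a s) := by
  have hT : 0 ≤ T := ht.1.trans ht.2
  -- A continuous extension to ℝ, so that the primitive is differentiable at the endpoints too.
  set A : ℝ → ℝ := IccExtend hT ((Icc 0 T).domRestrict a) with hA
  have hAc : Continuous A := ha.domRestrict.Icc_extend'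
  have hAa : ∀ s ∈ Icc 0 T, A s = a s := fun s hs ↦ by
    rw [hA, IccExtend_of_mem hT _ hs, domRestrict_apply]
  have hj : ∀ s, HasDerivAt (fun s ↦ ∫ r in (0 : ℝ)..s, A r) (A s) s :=
    fun s ↦ hAc.integral_hasStrictDerivAt 0 s |>.hasDerivAt
  have hg : ∀ s ∈ Icc 0 T, HasDerivWithinAt
      (fun s ↦ f s * Real.exp (-(k * ∫ r in (0 : ℝ)..s, A r))) 0 (Icc 0 T) s := by
    intro s hs
    have h := (hf s hs).mul (((hj s).const_mul k).neg.exp.hasDerivWithinAt (s := Icc 0 T))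
    refine h.congr_deriv ?_
    rw [hAa s hs]
    ring
  have hconst := constant_of_has_deriv_right_zero
    (fun s hs ↦ (hg s hs).continuousWithinAt)
    (fun s hs ↦ hasDerivWithinAt_Ici_of_Icc hs (hg s (Ico_subset_Icc_self hs))) t ht
  simp only [intervalIntegral.integral_same, mul_zero, neg_zero, Real.exp_zero, mul_one] at hconst
  have hint : ∫ s in (0 : ℝ)..t, a s = ∫ s in (0 : ℝ)..t, A s := by
    refine intervalIntegral.integral_congr fun s hs ↦ ?_
    rw [uIcc_of_le ht.1] at hs
    exact (hAa s ⟨hs.1, hs.2.trans ht.2⟩).symm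
  rw [hint, ← hconst, mul_assoc, ← Real.exp_add]
  simp

/-! ### Determinant and trace of endomorphisms. -/

variable {d : ℕ}

/-- The matrix of an endomorphism of `ℝ^d` in the canonical basis. -/
noncomputable def matrixOf (A : Space d →L[ℝ] Space d) : Matrix (Fin d) (Fin d) ℝ :=
  Matrix.of fun i j ↦ A (EuclideanSpace.single j 1) i

theorem det_eq_det_matrixOf (A : Space d →L[ℝ] Space d) : A.det = (matrixOf A).det := by
  rw [ContinuousLinearMap.det, ← LinearMap.det_toMatrix (EuclideanSpace.basisFun (Fin d) ℝ).toBasis]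
  congr 1

/-- The trace of an endomorphism of `ℝ^d`. -/
noncomputable def traceOf (A : Space d →L[ℝ] Space d) : ℝ := ∑ i, A (EuclideanSpace.single i 1) i

theorem trace_matrixOf (A : Space d →L[ℝ] Space d) : (matrixOf A).trace = traceOf A := rfl

theorem continuous_traceOf : Continuous (traceOf (d := d)) := by
  unfold traceOf
  fun_prop

theorem contDiff_det : ContDiff ℝ 1 (fun A : Space d →L[ℝ] Space d ↦ A.det) := by
  simp only [det_eq_det_matrixOf, Matrix.det_apply, matrixOf, Matrix.of_apply]
  refine ContDiff.sum fun σ _ ↦ ContDiff.const_smul _ (contDiff_prod fun i _ ↦ ?_)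
  fun_prop

theorem matrixOf_one_add_smul (r : ℝ) (A : Space d →L[ℝ] Space d) :
    matrixOf (1 + r • A) = 1 + r • matrixOf A := by
  ext i j
  simp [matrixOf, Matrix.one_apply]

/-- Since det(B + rAB) = det(1 + rA) det B, the expansion of the determinant at the identity
suffices, and B may be singular. -/
theorem fderiv_det_apply (A B : Space d →L[ℝ] Space d) :
    fderiv ℝ (fun A : Space d →L[ℝ] Space d ↦ A.det) B (A.comp B) = traceOf A * B.det := by
  have hd : DifferentiableAt ℝ (fun A : Space d →L[ℝ] Space d ↦ A.det) B :=
    contDiff_det.differentiable one_ne_zero B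
  have h1 : HasDerivAt (fun r : ℝ ↦ (B + r • A.comp B).det)
      (fderiv ℝ (fun A : Space d →L[ℝ] Space d ↦ A.det) B (A.comp B)) 0 :=
    hd.hasFDerivAt.hasLineDerivAt (A.comp B)
  obtain ⟨q, hq⟩ : ∃ q : Polynomial ℝ, ∀ r : ℝ,
      (1 + r • matrixOf A).det = 1 + (matrixOf A).trace * r + q.eval r * r ^ 2 :=
    ⟨_, fun r ↦ Matrix.det_one_add_smul r (matrixOf A)⟩
  have h2 : ∀ r : ℝ, (B + r • A.comp B).det =
      (1 + traceOf A * r + q.eval r * r ^ 2) * B.det := by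
    intro r
    have : B + r • A.comp B = (1 + r • A).comp B := by ext; simp
    rw [this, ← trace_matrixOf, ← hq, ← matrixOf_one_add_smul, ← det_eq_det_matrixOf]
    exact LinearMap.det_comp _ _
  have h3 : HasDerivAt (fun r : ℝ ↦ (B + r • A.comp B).det) (traceOf A * B.det) 0 := by
    simp only [h2]
    have := ((((hasDerivAt_id (0 : ℝ)).const_mul (traceOf A)).const_add 1).add
      ((q.hasDerivAt 0).mul ((hasDerivAt_id (0 : ℝ)).pow 2))).mul_const B.det
    refine this.congr_deriv ?_
    simp
  exact h1.unique h3

/-- Liouville's formula, infinitesimal form. -/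
theorem hasDerivWithinAt_det {Z : ℝ → Space d →L[ℝ] Space d} {A : Space d →L[ℝ] Space d}
    {s : Set ℝ} {t : ℝ} (hZ : HasDerivWithinAt Z (A.comp (Z t)) s t) :
    HasDerivWithinAt (fun t ↦ (Z t).det) (traceOf A * (Z t).det) s t := by
  rw [← fderiv_det_apply]
  exact (contDiff_det.differentiable one_ne_zero (Z t)).hasFDerivAt.comp_hasDerivWithinAt t hZ

theorem exists_det_one_add_smul_eq_eval (A : Space d →L[ℝ] Space d) :
    ∃ p : Polynomial ℝ, p.natDegree ≤ d ∧ ∀ r : ℝ, (1 + r • A).det = p.eval r := by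
  refine ⟨((Polynomial.X : Polynomial ℝ) • (matrixOf A).map Polynomial.C +
    (1 : Matrix (Fin d) (Fin d) ℝ).map Polynomial.C).det, ?_, fun r ↦ ?_⟩
  · simpa using Polynomial.natDegree_det_X_add_C_le (matrixOf A) 1
  · rw [det_eq_det_matrixOf, matrixOf_one_add_smul, ← Polynomial.coe_evalRingHom,
      RingHom.map_det]
    congr 1
    ext i j
    simp [Matrix.one_apply, add_comm (r * _), apply_ite, mul_comm _ r]

/-- The determinant of 1 + rA is a polynomial in r of degree at most d, determined by its values at
d + 1 nodes. This carries identities from small r to r = 1. -/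
theorem det_one_add_eq_sum (A : Space d →L[ℝ] Space d) {v : ℕ → ℝ} (hv : Function.Injective v) :
    (1 + A).det = ∑ i ∈ Finset.range (d + 1),
      (1 + v i • A).det * (Lagrange.basis (Finset.range (d + 1)) v i).eval 1 := by
  obtain ⟨p, hp, hpA⟩ := exists_det_one_add_smul_eq_eval A
  have hdeg : p.degree < (Finset.range (d + 1)).card := by
    rw [Finset.card_range]
    exact Polynomial.degree_le_natDegree.trans_lt (by exact_mod_cast Nat.lt_succ_of_le hp)
  have h1 := hpA 1
  rw [one_smul] at h1
  rw [h1, Lagrange.eq_interpolate (hv.injOn (s := Finset.range (d + 1))) hdeg,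
    Lagrange.interpolate_apply, Polynomial.eval_finsetSum]
  refine Finset.sum_congr rfl fun i _ ↦ ?_
  rw [Polynomial.eval_mul, Polynomial.eval_C, hpA]

/-! ### Integrals of Jacobian determinants: null Lagrangian and growth. -/

theorem measurable_det_one_add_smul_fderiv (H : Space d → Space d) (r : ℝ) :
    Measurable fun x ↦ (1 + r • fderiv ℝ H x).det := by
  have h : Continuous fun A : Space d →L[ℝ] Space d ↦ (1 + r • A).det :=
    ContinuousLinearMap.continuous_det.comp (by fun_prop)
  exact h.measurable.comp (measurable_fderiv ℝ H)

theorem integrableOn_det_one_add_smul {H : Space d → Space d} {K : ℝ≥0} (hK : LipschitzWith K H)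
    {Ω : Set (Space d)} (hΩ : Bornology.IsBounded Ω) (r : ℝ) :
    IntegrableOn (fun x ↦ (1 + r • fderiv ℝ H x).det) Ω := by
  have h : Continuous fun A : Space d →L[ℝ] Space d ↦ (1 + r • A).det :=
    ContinuousLinearMap.continuous_det.comp (by fun_prop)
  obtain ⟨C, hC⟩ := (isCompact_closedBall (0 : Space d →L[ℝ] Space d) K).exists_bound_of_continuousOn
    h.continuousOn
  refine Measure.integrableOn_of_bounded (M := C) hΩ.measure_lt_top.ne
    (measurable_det_one_add_smul_fderiv H r).aestronglyMeasurable ?_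
  exact Eventually.of_forall fun x ↦ hC _ (by
    rw [mem_closedBall_zero_iff]
    exact norm_fderiv_le_of_lipschitz ℝ hK)

theorem exists_det_one_add_pos :
    ∃ δ > 0, ∀ B : Space d →L[ℝ] Space d, ‖B‖ < δ → 0 < (1 + B).det := by
  have h : Continuous fun A : Space d →L[ℝ] Space d ↦ (1 + A).det :=
    ContinuousLinearMap.continuous_det.comp (by fun_prop)
  have h0 : (0 : ℝ) < (1 + (0 : Space d →L[ℝ] Space d)).det := by
    rw [add_zero]
    have : (1 : Space d →L[ℝ] Space d).det = 1 := LinearMap.det_id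
    rw [this]
    exact one_pos
  obtain ⟨δ, hδ, hB⟩ := Metric.mem_nhds_iff.1 (h.continuousAt.eventually (lt_mem_nhds h0))
  exact ⟨δ, hδ, fun B hB' ↦ hB (by simpa using hB')⟩

/-- The quantitative inverse function theorem for a contractive perturbation of the identity.
Dimension 0 is separate because there the identity has norm 0. -/
theorem bijective_id_add {H : Space d → Space d} {c : ℝ≥0} (hH : LipschitzWith c H)
    (hc : c < 1) : Function.Bijective fun x ↦ x + H x := by
  have hA : ApproximatesLinearOn (fun x ↦ x + H x)
      ((ContinuousLinearEquiv.refl ℝ (Space d) : Space d ≃L[ℝ] Space d) :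
        Space d →L[ℝ] Space d) univ c := by
    rw [ApproximatesLinearOn.approximatesLinearOn_iff_lipschitzOnWith]
    have e : (fun x ↦ x + H x) - ⇑((ContinuousLinearEquiv.refl ℝ (Space d) :
        Space d ≃L[ℝ] Space d) : Space d →L[ℝ] Space d) = H := by
      ext x
      simp
    rw [e]
    exact hH.lipschitzOnWith
  have hN : Subsingleton (Space d) ∨ c < ‖((ContinuousLinearEquiv.refl ℝ (Space d)).symm :
      Space d →L[ℝ] Space d)‖₊⁻¹ := by
    rcases subsingleton_or_nontrivial (Space d) with h | h
    · exact Or.inl h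
    · right
      have : ‖((ContinuousLinearEquiv.refl ℝ (Space d)).symm : Space d →L[ℝ] Space d)‖₊ = 1 := by
        ext
        exact ContinuousLinearMap.norm_id
      rwa [this, inv_one]
  exact ⟨injOn_univ.1 (hA.injOn hN), hA.surjective hN⟩

theorem setIntegral_det_one_add_eq_volume {H : Space d → Space d} {c : ℝ≥0}
    (hH : LipschitzWith c H) (hd : Differentiable ℝ H) (hc : c < 1)
    (hpos : ∀ x, 0 < (1 + fderiv ℝ H x).det) {Ω : Set (Space d)} (hΩ : MeasurableSet Ω) :
    ∫ x in Ω, (1 + fderiv ℝ H x).det = (volume.real ((fun x ↦ x + H x) '' Ω)) := by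
  have hder : ∀ x ∈ Ω, HasFDerivWithinAt (fun x ↦ x + H x) (1 + fderiv ℝ H x) Ω x :=
    fun x _ ↦ ((hasFDerivAt_id x).add (hd x).hasFDerivAt).hasFDerivWithinAt
  have := integral_image_eq_integral_abs_det_fderiv_smul volume hΩ hder
    (bijective_id_add hH hc).1.injOn (fun _ ↦ (1 : ℝ))
  simp only [smul_eq_mul, mul_one, abs_of_pos (hpos _), integral_const, measureReal_restrict_apply,
    MeasurableSet.univ, univ_inter] at this
  exact this.symm

/-- The Jacobian determinant is a null Lagrangian: its integral over a bounded set depends only on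
the values of the map outside of the set. -/
theorem setIntegral_det_one_add_fderiv_congr {H₁ H₂ : Space d → Space d} {K₁ K₂ : ℝ≥0}
    (hK₁ : LipschitzWith K₁ H₁) (hK₂ : LipschitzWith K₂ H₂)
    (hd₁ : Differentiable ℝ H₁) (hd₂ : Differentiable ℝ H₂)
    {Ω : Set (Space d)} (hΩ : MeasurableSet Ω) (hΩb : Bornology.IsBounded Ω)
    (heq : ∀ x ∉ Ω, H₁ x = H₂ x) :
    ∫ x in Ω, (1 + fderiv ℝ H₁ x).det = ∫ x in Ω, (1 + fderiv ℝ H₂ x).det := by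
  obtain ⟨δ, hδ, hdet⟩ := exists_det_one_add_pos (d := d)
  set K : ℝ≥0 := max K₁ K₂ with hK
  have hm : 0 < min δ 1 := lt_min hδ one_pos
  set ε : ℝ := min δ 1 / (K + 1) with hε
  have hεpos : 0 < ε := by positivity
  have small : ∀ r : ℝ, 0 < r → r ≤ ε → r * K < min δ 1 := by
    intro r hr hrε
    have h1 : r * (K + 1) ≤ min δ 1 := by rwa [hε, le_div_iff₀ (by positivity)] at hrε
    nlinarith
  have vol : ∀ {H : Space d → Space d}, LipschitzWith K H → Differentiable ℝ H →
      ∀ r : ℝ, 0 < r → r ≤ ε → Function.Bijective (fun x ↦ x + r • H x) ∧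
        ∫ x in Ω, (1 + r • fderiv ℝ H x).det = volume.real ((fun x ↦ x + r • H x) '' Ω) := by
    intro H hH hd r hr hrε
    have hs := small r hr hrε
    have hL : LipschitzWith (‖r‖₊ * K) (fun x ↦ r • H x) := (lipschitzWith_smul r).comp hH
    have hrn : ((‖r‖₊ * K : ℝ≥0) : ℝ) = r * K := by simp [abs_of_pos hr]
    have hlt : ‖r‖₊ * K < 1 := by
      rw [← NNReal.coe_lt_coe, hrn, NNReal.coe_one]
      exact hs.trans_le (min_le_right _ _)
    have hf : ∀ x, fderiv ℝ (fun x ↦ r • H x) x = r • fderiv ℝ H x :=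
      fun x ↦ fderiv_fun_const_smul (hd x) r
    refine ⟨bijective_id_add hL hlt, ?_⟩
    simp only [← hf]
    refine setIntegral_det_one_add_eq_volume hL (hd.const_smul r) hlt (fun x ↦ hdet _ ?_) hΩ
    refine (norm_fderiv_le_of_lipschitz ℝ hL).trans_lt ?_
    rw [hrn]
    exact hs.trans_le (min_le_left _ _)
  have hL₁ : LipschitzWith K H₁ := hK₁.weaken (le_max_left _ _)
  have hL₂ : LipschitzWith K H₂ := hK₂.weaken (le_max_right _ _)
  -- For small r both maps are bijections of the whole space that agree off Ω, so they have the same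
  -- image of Ω; as the Jacobians are positive, both integrals are its volume.
  have heqr : ∀ r : ℝ, 0 < r → r ≤ ε → ∫ x in Ω, (1 + r • fderiv ℝ H₁ x).det =
      ∫ x in Ω, (1 + r • fderiv ℝ H₂ x).det := by
    intro r hr hrε
    obtain ⟨b₁, e₁⟩ := vol hL₁ hd₁ r hr hrε
    obtain ⟨b₂, e₂⟩ := vol hL₂ hd₂ r hr hrε
    rw [e₁, e₂]
    have himg : (fun x ↦ x + r • H₁ x) '' Ωᶜ = (fun x ↦ x + r • H₂ x) '' Ωᶜ :=
      image_congr fun x hx ↦ by rw [heq x hx]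
    rw [image_compl_eq b₁, image_compl_eq b₂, compl_inj_iff] at himg
    rw [himg]
  -- Distinct interpolation nodes in (0, ε], where the equality is known.
  set v : ℕ → ℝ := fun n ↦ ε / (n + 1) with hv
  have hvinj : Function.Injective v := by
    intro m n hmn
    simp only [hv] at hmn
    field_simp at hmn
    exact_mod_cast (add_right_cancel hmn).symm
  have hvpos : ∀ n, 0 < v n := fun n ↦ by simp only [hv]; positivity
  have hvle : ∀ n, v n ≤ ε := fun n ↦ div_le_self hεpos.le (by simp)
  have hs₁ := fun x ↦ det_one_add_eq_sum (fderiv ℝ H₁ x) hvinj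
  have hs₂ := fun x ↦ det_one_add_eq_sum (fderiv ℝ H₂ x) hvinj
  simp only [hs₁, hs₂]
  rw [integral_finsetSum _ fun i _ ↦
      (integrableOn_det_one_add_smul hL₁ hΩb (v i)).mul_const _,
    integral_finsetSum _ fun i _ ↦
      (integrableOn_det_one_add_smul hL₂ hΩb (v i)).mul_const _]
  refine Finset.sum_congr rfl fun i _ ↦ ?_
  rw [integral_mul_const, integral_mul_const, heqr _ (hvpos i) (hvle i)]

/-- Growth of the volume of the free transport of a bounded set. -/
theorem exists_setIntegral_det_one_add_smul_le {u₀ : Space d → Space d} (hu : ContDiff ℝ 1 u₀)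
    {Ω : Set (Space d)} (hΩ : MeasurableSet Ω) (hΩb : Bornology.IsBounded Ω) :
    ∃ C : ℝ, 0 ≤ C ∧ ∀ t : ℝ, 1 ≤ t → ∫ x in Ω, (1 + t • fderiv ℝ u₀ x).det ≤
      t ^ d * ((∫ x in Ω, (fderiv ℝ u₀ x).det) + C / t) := by
  have hcont : Continuous (fderiv ℝ u₀) := hu.continuous_fderiv one_ne_zero
  have hcpt : IsCompact (closure Ω) := hΩb.isCompact_closure
  obtain ⟨M, hM⟩ := hcpt.exists_bound_of_continuousOn hcont.continuousOn
  -- The ball contains both ∇u₀ and t⁻¹ + ∇u₀ for t ≥ 1; on it the two determinants differ by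
  -- O(1/t).
  obtain ⟨L, hL⟩ := (contDiff_det (d := d)).locallyLipschitz.locallyLipschitzOn
    |>.exists_lipschitzOnWith_of_compact
    (isCompact_closedBall (0 : Space d →L[ℝ] Space d) (M + ‖(1 : Space d →L[ℝ] Space d)‖))
  refine ⟨L * ‖(1 : Space d →L[ℝ] Space d)‖ * volume.real Ω, by positivity, fun t ht ↦ ?_⟩
  have ht0 : 0 < t := by linarith
  have hint : ∀ a : ℝ, IntegrableOn (fun x ↦ (a • (1 : Space d →L[ℝ] Space d) +
      fderiv ℝ u₀ x).det) Ω := fun a ↦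
    ((ContinuousLinearMap.continuous_det.comp
      (hcont.const_add (a • 1))).continuousOn.integrableOn_compact hcpt).mono_set subset_closure
  have hscale : ∀ x, (1 + t • fderiv ℝ u₀ x).det =
      t ^ d * (t⁻¹ • (1 : Space d →L[ℝ] Space d) + fderiv ℝ u₀ x).det := by
    intro x
    have h : (1 + t • fderiv ℝ u₀ x) = t • (t⁻¹ • (1 : Space d →L[ℝ] Space d) + fderiv ℝ u₀ x) := by
      rw [smul_add, smul_smul, mul_inv_cancel₀ ht0.ne', one_smul]
    rw [h, ContinuousLinearMap.det, ContinuousLinearMap.toLinearMap_smul, LinearMap.det_smul,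
      finrank_euclideanSpace_fin, ContinuousLinearMap.det]
  simp only [hscale, integral_const_mul]
  refine mul_le_mul_of_nonneg_left ?_ (by positivity)
  have hle : ∀ x ∈ Ω, (t⁻¹ • (1 : Space d →L[ℝ] Space d) + fderiv ℝ u₀ x).det ≤
      (fderiv ℝ u₀ x).det + L * ‖(1 : Space d →L[ℝ] Space d)‖ / t := by
    intro x hx
    have hMx := hM x (subset_closure hx)
    have hnt : ‖t⁻¹ • (1 : Space d →L[ℝ] Space d)‖ = ‖(1 : Space d →L[ℝ] Space d)‖ / t := by
      rw [norm_smul, Real.norm_eq_abs, abs_of_pos (by positivity)]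
      ring
    have h1 := hL.dist_le_mul (t⁻¹ • (1 : Space d →L[ℝ] Space d) + fderiv ℝ u₀ x) (by
      rw [mem_closedBall_zero_iff]
      refine (norm_add_le _ _).trans ?_
      rw [hnt, add_comm]
      gcongr
      exact div_le_self (norm_nonneg _) ht) (fderiv ℝ u₀ x) (by
      rw [mem_closedBall_zero_iff]
      linarith [norm_nonneg (1 : Space d →L[ℝ] Space d)])
    rw [dist_eq_norm, dist_eq_norm, add_sub_cancel_right, hnt, Real.norm_eq_abs] at h1
    have := (abs_le.1 h1).2
    rw [mul_div_assoc]
    linarith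
  have hfin : volume Ω ≠ ⊤ := hΩb.measure_lt_top.ne
  have h0 : IntegrableOn (fun x ↦ (fderiv ℝ u₀ x).det) Ω := by
    exact ((ContinuousLinearMap.continuous_det.comp hcont).continuousOn.integrableOn_compact
      hcpt).mono_set subset_closure
  calc ∫ x in Ω, (t⁻¹ • (1 : Space d →L[ℝ] Space d) + fderiv ℝ u₀ x).det
      ≤ ∫ x in Ω, ((fderiv ℝ u₀ x).det + L * ‖(1 : Space d →L[ℝ] Space d)‖ / t) :=
        setIntegral_mono_on (hint _) (h0.add (integrableOn_const hfin)) hΩ hle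
    _ = _ := by
        rw [integral_add h0 (integrableOn_const hfin), setIntegral_const, smul_eq_mul]
        ring

/-! ### Functions that are jointly C¹ in time and space. -/

section JointlySmooth

variable {E F : Type*} [NormedAddCommGroup E] [NormedSpace ℝ E] [NormedAddCommGroup F]
  [NormedSpace ℝ F] {g : ℝ → E → F} {I : Set ℝ} {t : ℝ} {x : E}

theorem differentiableAt_uncurry (hI : IsOpen I)
    (hg : ContDiffOn ℝ 1 (fun p : ℝ × E ↦ g p.1 p.2) (I ×ˢ univ)) (ht : t ∈ I) (x : E) :
    DifferentiableAt ℝ (fun p : ℝ × E ↦ g p.1 p.2) (t, x) :=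
  (hg.differentiableOn one_ne_zero).differentiableAt
    ((hI.prod isOpen_univ).mem_nhds ⟨ht, mem_univ x⟩)

theorem hasFDerivAt_slice (hI : IsOpen I)
    (hg : ContDiffOn ℝ 1 (fun p : ℝ × E ↦ g p.1 p.2) (I ×ˢ univ)) (ht : t ∈ I) (x : E) :
    HasFDerivAt (g t) ((fderiv ℝ (fun p : ℝ × E ↦ g p.1 p.2) (t, x)).comp
      (ContinuousLinearMap.inr ℝ ℝ E)) x :=
  (differentiableAt_uncurry hI hg ht x).hasFDerivAt.comp x (hasFDerivAt_prodMk_right t x)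

theorem continuousOn_fderiv_slice (hI : IsOpen I)
    (hg : ContDiffOn ℝ 1 (fun p : ℝ × E ↦ g p.1 p.2) (I ×ˢ univ)) :
    ContinuousOn (fun p : ℝ × E ↦ fderiv ℝ (g p.1) p.2) (I ×ˢ univ) := by
  have h := hg.continuousOn_fderiv_of_isOpen (hI.prod isOpen_univ) le_rfl
  refine (h.clm_comp (continuousOn_const (c := ContinuousLinearMap.inr ℝ ℝ E))).congr fun p hp ↦ ?_
  exact (hasFDerivAt_slice hI hg hp.1 p.2).fderiv

theorem contDiff_slice
    (hg : ContDiffOn ℝ 1 (fun p : ℝ × E ↦ g p.1 p.2) (I ×ˢ univ)) (ht : t ∈ I) :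
    ContDiff ℝ 1 (g t) := by
  rw [← contDiffOn_univ]
  exact hg.comp (contDiff_prodMk_right t).contDiffOn fun x _ ↦ ⟨ht, mem_univ x⟩

/-- With y' = u along a trajectory, this is the material derivative of the Euler equations. -/
theorem hasDerivWithinAt_along (hI : IsOpen I)
    (hg : ContDiffOn ℝ 1 (fun p : ℝ × E ↦ g p.1 p.2) (I ×ˢ univ)) (ht : t ∈ I)
    {y : ℝ → E} {y' : E} {s : Set ℝ} (hy : HasDerivWithinAt y y' s t) :
    HasDerivWithinAt (fun τ ↦ g τ (y τ))
      (deriv (fun τ ↦ g τ (y t)) t + fderiv ℝ (g t) (y t) y') s t := by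
  have hD := (differentiableAt_uncurry hI hg ht (y t)).hasFDerivAt
  have h1 : HasDerivAt (fun τ ↦ g τ (y t))
      (fderiv ℝ (fun p : ℝ × E ↦ g p.1 p.2) (t, y t) (1, 0)) t :=
    HasFDerivAt.comp_hasDerivAt (f := fun τ ↦ (τ, y t)) t hD ((hasDerivAt_id t).prodMk (hasDerivAt_const t (y t)))
  have h2 := HasFDerivAt.comp_hasDerivWithinAt (f := fun τ ↦ (τ, y τ)) t hD
    ((hasDerivWithinAt_id t s).prodMk hy)
  refine h2.congr_deriv ?_
  rw [h1.deriv, (hasFDerivAt_slice hI hg ht (y t)).fderiv, ContinuousLinearMap.comp_apply,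
    ← map_add]
  simp

end JointlySmooth

/-! ### Flow of a compactly supported field, and cut-off functions. -/

/-- The flow of a compactly supported `C¹` vector field, with Liouville's formula. -/
theorem exists_flow {v : ℝ → Space d → Space d}
    (hv : ContDiff ℝ 1 (fun p : ℝ × Space d ↦ v p.1 p.2))
    (hs : HasCompactSupport (fun p : ℝ × Space d ↦ v p.1 p.2)) {T : ℝ} (hT : 0 ≤ T) :
    ∃ Y : ℝ → Space d → Space d, (∀ x, Y 0 x = x) ∧
      (∀ x, ∀ t ∈ Icc 0 T, HasDerivWithinAt (fun τ ↦ Y τ x) (v t (Y t x)) (Icc 0 T) t) ∧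
      ContinuousOn (fun p : ℝ × Space d ↦ Y p.1 p.2) (Icc 0 T ×ˢ univ) ∧
      (∀ t ∈ Icc 0 T, Function.Injective (Y t)) ∧
      (∃ K : ℝ≥0, ∀ t ∈ Icc 0 T, LipschitzWith K (Y t)) ∧
      ∀ t ∈ Icc 0 T, ∀ x, HasStrictFDerivAt (Y t) (fderiv ℝ (Y t) x) x ∧
        (fderiv ℝ (Y t) x).det = Real.exp (∫ s in (0 : ℝ)..t, divergence (v s) (Y s x)) := by
  have hvO : ContDiffOn ℝ 1 (fun p : ℝ × Space d ↦ v p.1 p.2) (univ ×ˢ univ) := hv.contDiffOn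
  obtain ⟨K, hK⟩ := hv.lipschitzWith_of_hasCompactSupport hs one_ne_zero
  have hlip : ∀ t, LipschitzWith K (v t) := fun t ↦ by
    refine LipschitzWith.of_dist_le_mul fun x y ↦ ?_
    have := hK.dist_le_mul (t, x) (t, y)
    rwa [Prod.dist_eq, dist_self, max_eq_right dist_nonneg] at this
  have hfd : ∀ t x, fderiv ℝ (v t) x = (fderiv ℝ (fun p : ℝ × Space d ↦ v p.1 p.2) (t, x)).comp
      (ContinuousLinearMap.inr ℝ ℝ (Space d)) :=
    fun t x ↦ (hasFDerivAt_slice isOpen_univ hvO (mem_univ t) x).fderiv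
  have hcont : Continuous (fun p : ℝ × Space d ↦ fderiv ℝ (v p.1) p.2) := by
    rw [← continuousOn_univ, ← univ_prod_univ]
    exact continuousOn_fderiv_slice isOpen_univ hvO
  have hcs : HasCompactSupport (fun p : ℝ × Space d ↦ fderiv ℝ (v p.1) p.2) := by
    refine (hs.fderiv (𝕜 := ℝ)).mono fun p hp ↦ ?_
    contrapose! hp
    rw [Function.notMem_support] at hp ⊢
    rw [hfd, hp, ContinuousLinearMap.zero_comp]
  have huc := hcs.uniformContinuous_of_continuous hcont
  have hdiff : ∀ t, Differentiable ℝ (v t) := fun t x ↦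
    (hasFDerivAt_slice isOpen_univ hvO (mem_univ t) x).differentiableAt
  choose α hα0 hα using fun x ↦ exists_solution_of_lipschitz hT (fun t _ ↦ hlip t)
    (fun x ↦ (hv.continuous.comp (Continuous.prodMk_left x)).continuousOn) x
  set Y : ℝ → Space d → Space d := fun t x ↦ α x t with hYdef
  have hY0 : ∀ x, Y 0 x = x := hα0
  have hY : ∀ x, ∀ t ∈ Icc 0 T, HasDerivWithinAt (fun τ ↦ Y τ x) (v t (Y t x)) (Icc 0 T) t := hα
  have hYc : ∀ x, ContinuousOn (fun t ↦ Y t x) (Icc 0 T) :=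
    fun x t ht ↦ (hY x t ht).continuousWithinAt
  have hYlip : ∀ t ∈ Icc 0 T, LipschitzWith (Real.exp (K * T)).toNNReal (Y t) := by
    intro t ht
    refine LipschitzWith.of_dist_le_mul fun x y ↦ ?_
    rw [Real.coe_toNNReal _ (Real.exp_pos _).le]
    have := dist_le_of_trajectories_ODE (v := v) (K := K) (a := 0) (b := T) (δ := dist x y)
      hlip (hYc x) (fun s hs ↦ hasDerivWithinAt_Ici_of_Icc hs (hY x s (Ico_subset_Icc_self hs)))
      (hYc y) (fun s hs ↦ hasDerivWithinAt_Ici_of_Icc hs (hY y s (Ico_subset_Icc_self hs)))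
      (by rw [hY0, hY0]) t ht
    refine this.trans ?_
    rw [mul_comm]
    gcongr
    linarith [ht.2]
  have hYcont : ContinuousOn (fun p : ℝ × Space d ↦ Y p.1 p.2) (Icc 0 T ×ˢ univ) :=
    continuousOn_prod_of_continuousOn_lipschitzOnWith' (fun p : ℝ × Space d ↦ Y p.1 p.2)
      (Real.exp (K * T)).toNNReal
      (fun t ht ↦ (hYlip t ht).lipschitzOnWith) (fun x _ ↦ hYc x)
  refine ⟨Y, hY0, hY, hYcont, ?_, ⟨_, hYlip⟩, ?_⟩
  · intro t ht x y hxy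
    have hsub : Icc 0 t ⊆ Icc 0 T := Icc_subset_Icc_right ht.2
    have hleft : ∀ x, ∀ s ∈ Ioc 0 t, HasDerivWithinAt (fun τ ↦ Y τ x) (v s (Y s x)) (Iic s) s :=
      fun x s hs ↦ (hY x s (hsub (Ioc_subset_Icc_self hs))).mono_of_mem_nhdsWithin
        (mem_of_superset (Icc_mem_nhdsLE_of_mem hs) hsub)
    have := ODE_solution_unique_of_mem_Icc_left (v := v) (s := fun _ ↦ univ) (K := K)
      (fun s _ ↦ (hlip s).lipschitzOnWith)
      ((hYc x).mono hsub) (hleft x) (fun _ _ ↦ mem_univ _)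
      ((hYc y).mono hsub) (hleft y) (fun _ _ ↦ mem_univ _) hxy
    have h0 := this (left_mem_Icc.2 ht.1)
    simpa only [hY0] using h0
  · intro t ht x
    have hA : ContinuousOn (fun t ↦ fderiv ℝ (v t) (Y t x)) (Icc 0 T) :=
      hcont.comp_continuousOn (continuousOn_id.prodMk (hYc x))
    obtain ⟨Z, hZ0, hZ⟩ := exists_solution_of_lipschitz (F := Space d →L[ℝ] Space d) (K := K)
      (f := fun t Z ↦ (fderiv ℝ (v t) (Y t x)).comp Z) hT (fun t _ ↦ by
        refine LipschitzWith.of_dist_le_mul fun A B ↦ ?_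
        rw [dist_eq_norm, dist_eq_norm, ← ContinuousLinearMap.comp_sub]
        refine (ContinuousLinearMap.opNorm_comp_le _ _).trans ?_
        gcongr
        exact norm_fderiv_le_of_lipschitz ℝ (hlip t))
      (fun B ↦ hA.clm_comp continuousOn_const) (ContinuousLinearMap.id ℝ (Space d))
    have hstrict := hasStrictFDerivAt_flow hdiff huc hlip hY0 hY hZ0 hZ ht
    have hfderiv : fderiv ℝ (Y t) x = Z t := hstrict.hasFDerivAt.fderiv
    rw [hfderiv]
    refine ⟨hstrict, ?_⟩
    have := eq_mul_exp_of_hasDerivWithinAt (k := 1) (f := fun t ↦ (Z t).det)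
      (a := fun t ↦ divergence (v t) (Y t x))
      (continuous_traceOf.comp_continuousOn hA)
      (fun s hs ↦ by
        rw [one_mul]
        exact hasDerivWithinAt_det (hZ s hs)) ht
    have hid : (ContinuousLinearMap.id ℝ (Space d)).det = 1 := LinearMap.det_id
    rwa [hZ0, hid, one_mul, one_mul] at this

/-- The value is 1 near each point of K, not merely on K, so that derivatives are unaffected by the
cut-off as well. -/
theorem exists_cutoff {E : Type*} [NormedAddCommGroup E] [NormedSpace ℝ E]
    [FiniteDimensional ℝ E] {K U : Set E} (hK : IsCompact K) (hU : IsOpen U) (hKU : K ⊆ U) :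
    ∃ φ : E → ℝ, ContDiff ℝ 1 φ ∧ HasCompactSupport φ ∧ tsupport φ ⊆ U ∧
      ∀ x ∈ K, ∀ᶠ y in 𝓝 x, φ y = 1 := by
  obtain ⟨L, hL, hKL, hLU⟩ := exists_compact_between hK hU hKU
  obtain ⟨f, hf1, hf0, -⟩ := exists_contMDiffMap_one_nhds_of_subset_interior
    (modelWithCornersSelf ℝ E) (n := 1) hK.isClosed hKL
  have hsupp : tsupport f ⊆ L := by
    refine closure_minimal (fun x hx ↦ ?_) hL.isClosed
    by_contra h
    exact hx (hf0 x h)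
  refine ⟨f, contMDiff_iff_contDiff.1 f.contMDiff, ?_, hsupp.trans hLU, fun x hx ↦ ?_⟩
  · exact hL.of_isClosed_subset (isClosed_tsupport _) hsupp
  · exact hf1.filter_mono (nhds_le_nhdsSet hx)

theorem contDiff_cutoff_smul {E F : Type*} [NormedAddCommGroup E] [NormedSpace ℝ E]
    [NormedAddCommGroup F] [NormedSpace ℝ F] {φ : E → ℝ} {g : E → F} {U : Set E}
    (hφ : ContDiff ℝ 1 φ) (hU : IsOpen U) (hφU : tsupport φ ⊆ U) (hg : ContDiffOn ℝ 1 g U) :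
    ContDiff ℝ 1 (fun x ↦ φ x • g x) := by
  rw [contDiff_iff_contDiffAt]
  intro x
  by_cases hx : x ∈ tsupport φ
  · exact hφ.contDiffAt.smul (hg.contDiffAt (hU.mem_nhds (hφU hx)))
  · refine contDiffAt_const (c := (0 : F)) |>.congr_of_eventuallyEq ?_
    have := notMem_tsupport_iff_eventuallyEq.1 hx
    filter_upwards [this] with y hy
    rw [hy, Pi.zero_apply, zero_smul]

/-! ### Classical solutions and vacuum particles. -/

/-- Classical solutions of the symmetric Euler system, in terms of the sound speed itself. -/
structure ClassicalEuler (κ : ℝ) (I : Set ℝ) (c : ℝ → Space d → ℝ)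
    (u : ℝ → Space d → Space d) : Prop where
  isOpen : IsOpen I
  sound_C1 : ContDiffOn ℝ 1 (fun p : ℝ × Space d ↦ c p.1 p.2) (I ×ˢ univ)
  velocity_C1 : ContDiffOn ℝ 1 (fun p : ℝ × Space d ↦ u p.1 p.2) (I ×ˢ univ)
  sound_eq : ∀ t ∈ I, ∀ x, deriv (fun τ ↦ c τ x) t + fderiv ℝ (c t) x (u t x) +
    κ * c t x * divergence (u t) x = 0
  velocity_eq : ∀ t ∈ I, ∀ x, deriv (fun τ ↦ u τ x) t + fderiv ℝ (u t) x (u t x) +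
    (c t x / κ) • gradient (c t) x = 0

theorem fderiv_div_const_real (f : Space d → ℝ) (k : ℝ) (x : Space d) :
    fderiv ℝ (fun y ↦ f y / k) x = k⁻¹ • fderiv ℝ f x := by
  simp only [div_eq_inv_mul]
  exact congrFun (fderiv_const_smul_field (𝕜 := ℝ) k⁻¹) x

theorem gradient_div_const (f : Space d → ℝ) (k : ℝ) (x : Space d) :
    gradient (fun y ↦ f y / k) x = k⁻¹ • gradient f x := by
  rw [gradient, fderiv_div_const_real, gradient]
  simp

theorem norm_gradient_eq (f : Space d → ℝ) (x : Space d) : ‖gradient f x‖ = ‖fderiv ℝ f x‖ := by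
  rw [gradient, LinearIsometryEquiv.norm_map]

theorem IsSmoothSolution.classicalEuler {γ s : ℝ} (hγ : 1 < γ) {I : Set ℝ} (hI : IsOpen I)
    {c₀ : Space d → ℝ} {u₀ : Space d → Space d} {c : ℝ → Space d → ℝ}
    {u : ℝ → Space d → Space d} (h : IsSmoothSolution γ s I c₀ u₀ c u) :
    ClassicalEuler ((γ - 1) / 2) I c u := by
  have hκ : (γ - 1) / 2 ≠ 0 := by
    have : 0 < γ - 1 := by linarith
    positivity
  refine ⟨hI, h.sound_C1, h.velocity_C1, fun t ht x ↦ ?_, fun t ht x ↦ ?_⟩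
  · have h1 := (h.euler t ht x).1
    simp only [deriv_div_const, fderiv_div_const_real, smul_apply, smul_eq_mul] at h1
    generalize (γ - 1) / 2 = k at hκ h1
    rw [← mul_zero k, ← h1]
    field_simp
  · have h1 := (h.euler t ht x).2
    simp only [gradient_div_const, smul_smul] at h1
    convert h1 using 3
    field_simp

namespace ClassicalEuler

variable {κ T : ℝ} {I : Set ℝ} {c : ℝ → Space d → ℝ} {u : ℝ → Space d → Space d}

/-- Fluid particles that start in the vacuum move freely. -/
theorem vacuum (h : ClassicalEuler κ I c u) (hκ : 0 < κ) (hTI : Icc 0 T ⊆ I)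
    {x : Space d} (hx : c 0 x = 0) {t : ℝ} (ht : t ∈ Icc 0 T) :
    c t (x + t • u 0 x) = 0 ∧ u t (x + t • u 0 x) = u 0 x := by
  set y : ℝ → Space d := fun t ↦ x + t • u 0 x with hy
  have hyd : ∀ s, HasDerivAt y (u 0 x) s := fun s ↦
    (((hasDerivAt_id s).smul_const (u 0 x)).const_add x).congr_deriv (one_smul _ _)
  have hyc : Continuous y := by fun_prop
  have hcurve : ContinuousOn (fun s ↦ (s, y s)) (Icc 0 T) := by fun_prop
  have hmaps : MapsTo (fun s ↦ (s, y s)) (Icc 0 T) (I ×ˢ univ) := fun s hs ↦ ⟨hTI hs, mem_univ _⟩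
  have hDu := (continuousOn_fderiv_slice h.isOpen h.velocity_C1).comp hcurve hmaps
  have hDc := (continuousOn_fderiv_slice h.isOpen h.sound_C1).comp hcurve hmaps
  have hdiv : ContinuousOn (fun s ↦ divergence (u s) (y s)) (Icc 0 T) :=
    continuous_traceOf.comp_continuousOn hDu
  obtain ⟨A, hA⟩ := isCompact_Icc.exists_bound_of_continuousOn hDu
  obtain ⟨B, hB⟩ := isCompact_Icc.exists_bound_of_continuousOn hDc
  obtain ⟨D, hD⟩ := isCompact_Icc.exists_bound_of_continuousOn hdiv
  simp only [Function.comp_apply] at hA hB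
  have hder : ∀ s ∈ Icc 0 T, HasDerivWithinAt (fun s ↦ (u s (y s) - u 0 x, c s (y s)))
      (deriv (fun τ ↦ u τ (y s)) s + fderiv ℝ (u s) (y s) (u 0 x),
        deriv (fun τ ↦ c τ (y s)) s + fderiv ℝ (c s) (y s) (u 0 x)) (Icc 0 T) s := fun s hs ↦
    ((hasDerivWithinAt_along h.isOpen h.velocity_C1 (hTI hs)
      (hyd s).hasDerivWithinAt).sub_const _).prodMk
      (hasDerivWithinAt_along h.isOpen h.sound_C1 (hTI hs) (hyd s).hasDerivWithinAt)
  have hz := eq_zero_of_abs_deriv_le_mul_abs_self_of_eq_zero_right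
    (K := A + B / κ + (B + κ * D))
    (fun s hs ↦ (hder s hs).continuousWithinAt)
    (fun s hs ↦ hasDerivWithinAt_Ici_of_Icc hs (hder s (Ico_subset_Icc_self hs)))
    (by simp [hy, hx]) (fun s hs ↦ by
      have hs' := Ico_subset_Icc_self hs
      have hA0 := (norm_nonneg _).trans (hA s hs')
      have hB0 := (norm_nonneg _).trans (hB s hs')
      have hD0 := (norm_nonneg _).trans (hD s hs')
      set w := u s (y s) - u 0 x with hw
      set q := c s (y s) with hq
      -- The line moves with velocity u 0 x instead of u; the discrepancy w enters linearly. With q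
      -- it satisfies a linear system whose coefficients are bounded along the segment, so Gronwall
      -- applies without knowing in advance that the line is a trajectory.
      have e1 : deriv (fun τ ↦ u τ (y s)) s + fderiv ℝ (u s) (y s) (u 0 x) =
          -(fderiv ℝ (u s) (y s) w + (q / κ) • gradient (c s) (y s)) := by
        have := h.velocity_eq s (hTI hs') (y s)
        rw [hw, map_sub, ← sub_eq_zero, ← this]
        abel
      have e2 : deriv (fun τ ↦ c τ (y s)) s + fderiv ℝ (c s) (y s) (u 0 x) =
          -(fderiv ℝ (c s) (y s) w + κ * q * divergence (u s) (y s)) := by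
        have := h.sound_eq s (hTI hs') (y s)
        rw [hw, map_sub]
        linarith
      have hwle : ‖w‖ ≤ ‖(w, q)‖ := norm_fst_le (w, q)
      have hqle : ‖q‖ ≤ ‖(w, q)‖ := norm_snd_le (w, q)
      set N := ‖(w, q)‖
      have hN0 : 0 ≤ N := (norm_nonneg _).trans hwle
      have b1 : ‖fderiv ℝ (u s) (y s) w + (q / κ) • gradient (c s) (y s)‖ ≤ (A + B / κ) * N := by
        refine (norm_add_le _ _).trans ?_
        rw [add_mul]
        refine add_le_add ?_ ?_
        · exact (ContinuousLinearMap.le_opNorm _ _).trans (by gcongr; exact hA s hs')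
        · rw [norm_smul, norm_gradient_eq, norm_div, Real.norm_of_nonneg hκ.le,
            div_mul_eq_mul_div, div_mul_eq_mul_div, mul_comm B]
          gcongr
          exact hB s hs'
      have b2 : ‖fderiv ℝ (c s) (y s) w + κ * q * divergence (u s) (y s)‖ ≤ (B + κ * D) * N := by
        refine (norm_add_le _ _).trans ?_
        rw [add_mul]
        refine add_le_add ?_ ?_
        · exact (ContinuousLinearMap.le_opNorm _ _).trans (by gcongr; exact hB s hs')
        · rw [norm_mul, norm_mul, Real.norm_of_nonneg hκ.le, mul_assoc, mul_assoc, mul_comm D]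
          gcongr
          exact hD s hs'
      rw [e1, e2, Prod.norm_mk, norm_neg, norm_neg, add_mul]
      have p1 : 0 ≤ (A + B / κ) * N := by positivity
      have p2 : 0 ≤ (B + κ * D) * N := by positivity
      exact max_le (by linarith) (by linarith)) t ht
  rw [Prod.mk_eq_zero, sub_eq_zero] at hz
  exact ⟨hz.2, hz.1⟩

end ClassicalEuler

/-! ### The particle flow. -/

/-- A maximum principle: Φ is open by the inverse function theorem, so a positive maximum of ‖Φ‖
cannot be interior; points slightly farther on the ray through Φ z would also be values. -/
theorem norm_le_of_forall_sphere {Φ : Space d → Space d} {r R : ℝ} (hR : 0 ≤ R)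
    (hΦ : Continuous Φ)
    (hΦ' : ∀ x, HasStrictFDerivAt Φ (fderiv ℝ Φ x) x ∧ (fderiv ℝ Φ x).det ≠ 0)
    (hsphere : ∀ x, ‖x‖ = r → ‖Φ x‖ ≤ R) {x : Space d} (hx : ‖x‖ ≤ r) : ‖Φ x‖ ≤ R := by
  obtain ⟨z, hz, hmax⟩ := (isCompact_closedBall (0 : Space d) r).exists_isMaxOn
    ⟨x, by simpa using hx⟩ hΦ.norm.continuousOn
  have hxz : ‖Φ x‖ ≤ ‖Φ z‖ := hmax (by simpa using hx)
  refine hxz.trans ?_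
  rw [mem_closedBall_zero_iff] at hz
  rcases hz.eq_or_lt with hz | hz
  · exact hsphere z hz
  by_contra! hcon
  have hmap := HasStrictFDerivAt.map_nhds_eq_of_equiv
    (f' := (fderiv ℝ Φ z).toContinuousLinearEquivOfDetNeZero (hΦ' z).2)
    (by simpa using (hΦ' z).1)
  have hloc : ∀ᶠ y in 𝓝 (Φ z), ‖y‖ ≤ ‖Φ z‖ := by
    rw [← hmap, eventually_map]
    have : Metric.ball (0 : Space d) r ∈ 𝓝 z := Metric.isOpen_ball.mem_nhds (by simpa using hz)
    filter_upwards [this] with y hy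
    exact hmax (Metric.ball_subset_closedBall hy)
  have htend : Tendsto (fun ε : ℝ ↦ (1 + ε) • Φ z) (𝓝[>] 0) (𝓝 (Φ z)) := by
    have : Tendsto (fun ε : ℝ ↦ (1 + ε) • Φ z) (𝓝 0) (𝓝 ((1 + (0 : ℝ)) • Φ z)) :=
      Continuous.tendsto (by fun_prop) 0
    rw [add_zero, one_smul] at this
    exact this.mono_left nhdsWithin_le_nhds
  obtain ⟨ε, hε, hε0⟩ := ((htend.eventually hloc).and self_mem_nhdsWithin).exists
  have hε0' : 0 < ε := hε0
  rw [norm_smul, Real.norm_of_nonneg (by linarith)] at hε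
  nlinarith [hR.trans_lt hcon]

/-- `Y` extends the particle trajectories, over the time interval `[0, T]`, of the particles that
start in the ball of radius `R`. -/
structure ParticleFlow (R T : ℝ) (c : ℝ → Space d → ℝ) (u : ℝ → Space d → Space d)
    (Y : ℝ → Space d → Space d) : Prop where
  init : ∀ x, Y 0 x = x
  continuousOn : ContinuousOn (fun p : ℝ × Space d ↦ Y p.1 p.2) (Icc 0 T ×ˢ univ)
  injective : ∀ t ∈ Icc 0 T, Function.Injective (Y t)
  lipschitz : ∀ t ∈ Icc 0 T, ∃ K : ℝ≥0, LipschitzWith K (Y t)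
  hasStrictFDerivAt : ∀ t ∈ Icc 0 T, ∀ x, HasStrictFDerivAt (Y t) (fderiv ℝ (Y t) x) x
  det_pos : ∀ t ∈ Icc 0 T, ∀ x, 0 < (fderiv ℝ (Y t) x).det
  hasDerivWithinAt : ∀ x, ‖x‖ < R → ∀ t ∈ Icc 0 T,
    HasDerivWithinAt (fun τ ↦ Y τ x) (u t (Y t x)) (Icc 0 T) t
  det_eq : ∀ x, ‖x‖ < R → ∀ t ∈ Icc 0 T,
    (fderiv ℝ (Y t) x).det = Real.exp (∫ s in (0 : ℝ)..t, divergence (u s) (Y s x))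
  free : ∀ x, ‖x‖ < R → c 0 x = 0 → ∀ t ∈ Icc 0 T, Y t x = x + t • u 0 x

/-- Y is the flow of a truncation of u. The sphere ‖x‖ = R lies in the vacuum and moves freely,
within radius R + T M; the maximum principle extends this bound to the ball, so its particles never
meet the truncation. No global bound on u enters. -/
theorem ClassicalEuler.exists_particleFlow {κ T : ℝ} {I : Set ℝ} {c : ℝ → Space d → ℝ}
    {u : ℝ → Space d → Space d} (h : ClassicalEuler κ I c u) (hκ : 0 < κ) (hT : 0 ≤ T)
    (hTI : Icc 0 T ⊆ I) {R : ℝ} (hR : 0 < R) (hcR : ∀ x, ‖x‖ = R → c 0 x = 0) :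
    ∃ Y, ParticleFlow R T c u Y := by
  have h0 : (0 : ℝ) ∈ I := hTI ⟨le_rfl, hT⟩
  obtain ⟨M, hM⟩ := (isCompact_closedBall (0 : Space d) R).exists_bound_of_continuousOn
    (contDiff_slice h.velocity_C1 h0).continuous.continuousOn
  set R' : ℝ := R + T * M with hR'
  have hM0 : 0 ≤ M := (norm_nonneg _).trans (hM 0 (by simp [hR.le]))
  have hR'0 : 0 ≤ R' := by positivity
  obtain ⟨φ, hφC, hφs, hφU, hφ1⟩ := exists_cutoff
    (K := Icc 0 T ×ˢ Metric.closedBall (0 : Space d) R') (U := I ×ˢ univ)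
    (isCompact_Icc.prod (isCompact_closedBall _ _)) (h.isOpen.prod isOpen_univ)
    (prod_mono hTI (subset_univ _))
  set v : ℝ → Space d → Space d := fun t x ↦ φ (t, x) • u t x with hv
  have hvC : ContDiff ℝ 1 (fun p : ℝ × Space d ↦ v p.1 p.2) :=
    contDiff_cutoff_smul hφC (h.isOpen.prod isOpen_univ) hφU h.velocity_C1
  have hvs : HasCompactSupport (fun p : ℝ × Space d ↦ v p.1 p.2) := hφs.smul_right
  obtain ⟨Y, hY0, hY, hYc, hYi, ⟨L, hYL⟩, hYd⟩ := exists_flow hvC hvs hT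
  obtain ⟨K, hK⟩ := hvC.lipschitzWith_of_hasCompactSupport hvs one_ne_zero
  have hlip : ∀ t, LipschitzWith K (v t) := fun t ↦ by
    refine LipschitzWith.of_dist_le_mul fun x y ↦ ?_
    have := hK.dist_le_mul (t, x) (t, y)
    rwa [Prod.dist_eq, dist_self, max_eq_right dist_nonneg] at this
  have hvu : ∀ t ∈ Icc 0 T, ∀ x : Space d, ‖x‖ ≤ R' → v t =ᶠ[𝓝 x] u t := by
    intro t ht x hx
    have h1 := hφ1 (t, x) ⟨ht, by simpa using hx⟩
    have h2 : Tendsto (fun y : Space d ↦ (t, y)) (𝓝 x) (𝓝 (t, x)) :=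
      (Continuous.prodMk_right t).tendsto x
    filter_upwards [h2.eventually h1] with y hy
    simp only [hv, hy, one_smul]
  have hfree : ∀ x, ‖x‖ ≤ R → c 0 x = 0 → ∀ t ∈ Icc 0 T,
      Y t x = x + t • u 0 x ∧ ‖Y t x‖ ≤ R' := by
    intro x hx hcx
    have hbd : ∀ t ∈ Icc 0 T, ‖x + t • u 0 x‖ ≤ R' := by
      intro t ht
      refine (norm_add_le _ _).trans (add_le_add hx ?_)
      rw [norm_smul, Real.norm_of_nonneg ht.1]
      gcongr
      · exact ht.2
      · exact hM x (by simpa using hx)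
    have hline : ∀ s ∈ Icc 0 T, HasDerivWithinAt (fun t : ℝ ↦ x + t • u 0 x)
        (v s (x + s • u 0 x)) (Icc 0 T) s := by
      intro s hs
      have e : v s (x + s • u 0 x) = u 0 x := by
        rw [(hvu s hs _ (hbd s hs)).self_of_nhds]
        exact (h.vacuum hκ hTI hcx hs).2
      rw [e]
      exact ((((hasDerivAt_id s).smul_const (u 0 x)).const_add x).congr_deriv
        (one_smul _ _)).hasDerivWithinAt
    have huniq := ODE_solution_unique_of_mem_Icc_right (v := v) (s := fun _ ↦ univ) (K := K)
      (fun s _ ↦ (hlip s).lipschitzOnWith)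
      (fun s hs ↦ (hY x s hs).continuousWithinAt)
      (fun s hs ↦ hasDerivWithinAt_Ici_of_Icc hs (hY x s (Ico_subset_Icc_self hs)))
      (fun _ _ ↦ mem_univ _)
      (fun s hs ↦ (hline s hs).continuousWithinAt)
      (fun s hs ↦ hasDerivWithinAt_Ici_of_Icc hs (hline s (Ico_subset_Icc_self hs)))
      (fun _ _ ↦ mem_univ _) (by simp [hY0])
    intro t ht
    have e : Y t x = x + t • u 0 x := huniq ht
    exact ⟨e, e ▸ hbd t ht⟩
  have hpos : ∀ t ∈ Icc 0 T, ∀ x, 0 < (fderiv ℝ (Y t) x).det := fun t ht x ↦ by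
    rw [(hYd t ht x).2]
    exact Real.exp_pos _
  have hconf : ∀ t ∈ Icc 0 T, ∀ x, ‖x‖ ≤ R → ‖Y t x‖ ≤ R' := fun t ht x hx ↦
    norm_le_of_forall_sphere hR'0 (hYL t ht).continuous
      (fun x ↦ ⟨(hYd t ht x).1, (hpos t ht x).ne'⟩)
      (fun z hz ↦ (hfree z hz.le (hcR z hz) t ht).2) hx
  refine ⟨Y, hY0, hYc, hYi, fun t ht ↦ ⟨L, hYL t ht⟩, fun t ht x ↦ (hYd t ht x).1, hpos,
    fun x hx t ht ↦ ?_, fun x hx t ht ↦ ?_, fun x hx hcx t ht ↦ (hfree x hx.le hcx t ht).1⟩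
  · rw [← (hvu t ht _ (hconf t ht x hx.le)).self_of_nhds]
    exact hY x t ht
  · rw [(hYd t ht x).2]
    congr 1
    refine intervalIntegral.integral_congr fun s hs ↦ ?_
    rw [uIcc_of_le ht.1] at hs
    have hs' : s ∈ Icc 0 T := ⟨hs.1, hs.2.trans ht.2⟩
    simp only [divergence, (hvu s hs' _ (hconf s hs' x hx.le)).fderiv_eq]

namespace ParticleFlow

variable {κ R T : ℝ} {I : Set ℝ} {c : ℝ → Space d → ℝ} {u Y : ℝ → Space d → Space d}

theorem continuousOn_time (hY : ParticleFlow R T c u Y) (x : Space d) :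
    ContinuousOn (fun t ↦ Y t x) (Icc 0 T) :=
  hY.continuousOn.comp (f := fun t ↦ (t, x)) (by fun_prop) fun _ ht ↦ ⟨ht, mem_univ _⟩

/-- Conservation of mass: the sound speed equation along a trajectory and Liouville's formula
integrate the same divergence. -/
theorem sound_eq (hY : ParticleFlow R T c u Y) (h : ClassicalEuler κ I c u) (hTI : Icc 0 T ⊆ I)
    {x : Space d} (hx : ‖x‖ < R) {t : ℝ} (ht : t ∈ Icc 0 T) :
    c t (Y t x) = c 0 x * (fderiv ℝ (Y t) x).det ^ (-κ) := by
  have hcurve : ContinuousOn (fun s ↦ (s, Y s x)) (Icc 0 T) :=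
    continuousOn_id.prodMk (hY.continuousOn_time x)
  have hDu := (continuousOn_fderiv_slice h.isOpen h.velocity_C1).comp hcurve
    fun s hs ↦ ⟨hTI hs, mem_univ _⟩
  have := eq_mul_exp_of_hasDerivWithinAt (k := -κ) (f := fun t ↦ c t (Y t x))
    (a := fun s ↦ divergence (u s) (Y s x)) (continuous_traceOf.comp_continuousOn hDu)
    (fun s hs ↦ (hasDerivWithinAt_along h.isOpen h.sound_C1 (hTI hs)
      (hY.hasDerivWithinAt x hx s hs)).congr_deriv (by
        linarith [h.sound_eq s (hTI hs) (Y s x)])) ht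
  rw [hY.init] at this
  rw [this, hY.det_eq x hx t ht, ← Real.exp_mul, mul_comm (-κ)]

/-- Particles outside Ω move freely, so the cut-off displacements χ (Y t - id) and χ t u₀ agree off
Ω, and the null Lagrangian property applies. -/
theorem setIntegral_det_eq (hY : ParticleFlow R T c u Y) (hu : ContDiff ℝ 1 (u 0))
    {Ω : Set (Space d)} (hΩ : IsOpen Ω) (hΩR : closure Ω ⊆ Metric.ball 0 R)
    (hc : ∀ x ∉ Ω, c 0 x = 0) {t : ℝ} (ht : t ∈ Icc 0 T) :
    ∫ x in Ω, (fderiv ℝ (Y t) x).det = ∫ x in Ω, (1 + t • fderiv ℝ (u 0) x).det := by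
  have hΩb : Bornology.IsBounded Ω := Metric.isBounded_ball.subset (subset_closure.trans hΩR)
  obtain ⟨χ, hχC, hχs, hχU, hχ1⟩ := exists_cutoff hΩb.isCompact_closure Metric.isOpen_ball hΩR
  have hYdiff : Differentiable ℝ (Y t) := fun x ↦ (hY.hasStrictFDerivAt t ht x).differentiableAt
  have hχd : Differentiable ℝ χ := hχC.differentiable one_ne_zero
  obtain ⟨L, hL⟩ := hY.lipschitz t ht
  have hH₂C : ContDiff ℝ 1 (fun x ↦ χ x • (t • u 0 x)) := by fun_prop
  obtain ⟨K₂, hK₂⟩ : ∃ K₂, LipschitzWith K₂ (fun x ↦ χ x • (t • u 0 x)) := hH₂C.lipschitzWith_of_hasCompactSupport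
    (hχs.smul_right (f' := fun x ↦ t • u 0 x)) one_ne_zero
  have hder : ∀ x, fderiv ℝ (fun x ↦ χ x • (Y t x - x)) x =
      χ x • (fderiv ℝ (Y t) x - ContinuousLinearMap.id ℝ (Space d)) +
        (fderiv ℝ χ x).smulRight (Y t x - x) := fun x ↦
    ((hχd x).hasFDerivAt.smul ((hYdiff x).hasFDerivAt.sub (hasFDerivAt_id x))).fderiv
  obtain ⟨B₁, hB₁⟩ := hχC.continuous.bounded_above_of_compact_support hχs
  obtain ⟨B₂, hB₂⟩ := (hχC.continuous_fderiv one_ne_zero).bounded_above_of_compact_support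
    (hχs.fderiv (𝕜 := ℝ))
  obtain ⟨B₃, hB₃⟩ := (isCompact_closedBall (0 : Space d) R).exists_bound_of_continuousOn
    (hL.continuous.sub continuous_id).continuousOn
  have hB₁0 := (norm_nonneg _).trans (hB₁ 0)
  have hB₂0 := (norm_nonneg _).trans (hB₂ 0)
  -- `ParticleFlow` does not record that Y t is C¹, so the Lipschitz constant comes from a bound on
  -- the derivative.
  have hK₁ : LipschitzWith (B₁ * (L + 1) + B₂ * |B₃|).toNNReal (fun x ↦ χ x • (Y t x - x)) := by
    refine lipschitzWith_of_nnnorm_fderiv_le (𝕜 := ℝ)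
      (hχd.smul (hYdiff.sub differentiable_id)) fun x ↦ ?_
    rw [← NNReal.coe_le_coe, coe_nnnorm, Real.coe_toNNReal _ (by positivity)]
    by_cases hx : x ∈ tsupport χ
    · have hxR : x ∈ Metric.closedBall (0 : Space d) R := Metric.ball_subset_closedBall (hχU hx)
      rw [hder]
      refine (norm_add_le _ _).trans (add_le_add ?_ ?_)
      · rw [norm_smul]
        gcongr
        · exact hB₁ x
        · exact (norm_sub_le _ _).trans (add_le_add (norm_fderiv_le_of_lipschitz ℝ hL)
            ContinuousLinearMap.norm_id_le)
      · rw [ContinuousLinearMap.norm_smulRight_apply]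
        gcongr
        · exact hB₂ x
        · exact (hB₃ x hxR).trans (le_abs_self _)
    · have hz : (fun x ↦ χ x • (Y t x - x)) =ᶠ[𝓝 x] fun _ ↦ 0 := by
        filter_upwards [notMem_tsupport_iff_eventuallyEq.1 hx] with y hy
        rw [hy, Pi.zero_apply, zero_smul]
      rw [hz.fderiv_eq, fderiv_const_apply, norm_zero]
      positivity
  have key := setIntegral_det_one_add_fderiv_congr hK₁ hK₂
    (hχd.smul (hYdiff.sub differentiable_id)) (hH₂C.differentiable one_ne_zero)
    hΩ.measurableSet hΩb (fun x hx ↦ by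
      by_cases hxR : x ∈ Metric.ball (0 : Space d) R
      · rw [hY.free x (by simpa using hxR) (hc x hx) t ht, add_sub_cancel_left]
      · have : χ x = 0 := by
          by_contra hne
          exact hxR (hχU (subset_tsupport _ hne))
        simp only [this, zero_smul])
  have e₁ : ∀ x ∈ Ω, (1 + fderiv ℝ (fun x ↦ χ x • (Y t x - x)) x).det =
      (fderiv ℝ (Y t) x).det := by
    intro x hx
    have hz : (fun x ↦ χ x • (Y t x - x)) =ᶠ[𝓝 x] fun x ↦ Y t x - x := by
      filter_upwards [hχ1 x (subset_closure hx)] with y hy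
      rw [hy, one_smul]
    have : fderiv ℝ (fun x ↦ Y t x - x) x = fderiv ℝ (Y t) x - 1 :=
      ((hYdiff x).hasFDerivAt.sub (hasFDerivAt_id x)).fderiv
    rw [hz.fderiv_eq, this, add_sub_cancel]
  have e₂ : ∀ x ∈ Ω, (1 + fderiv ℝ (fun x ↦ χ x • (t • u 0 x)) x).det =
      (1 + t • fderiv ℝ (u 0) x).det := by
    intro x hx
    have hz : (fun x ↦ χ x • (t • u 0 x)) =ᶠ[𝓝 x] fun x ↦ t • u 0 x := by
      filter_upwards [hχ1 x (subset_closure hx)] with y hy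
      rw [hy, one_smul]
    rw [hz.fderiv_eq, fderiv_fun_const_smul (hu.differentiable one_ne_zero x)]
  rwa [setIntegral_congr_fun hΩ.measurableSet e₁, setIntegral_congr_fun hΩ.measurableSet e₂] at key

end ParticleFlow

/-! ### Divergence theorem and integrals depending on time. -/

theorem sum_single_smul (w : Space d) :
    w = ∑ i, w i • (EuclideanSpace.single i (1 : ℝ) : Space d) := by
  have := (EuclideanSpace.basisFun (Fin d) ℝ).sum_repr w
  simpa using this.symm

/-- The divergence theorem for a compactly supported field. -/
theorem integral_fderiv_add_mul_divergence_eq_zero {p : Space d → ℝ} {w : Space d → Space d}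
    (hp : ContDiff ℝ 1 p) (hw : ContDiff ℝ 1 w) (hws : HasCompactSupport w) :
    ∫ y, (fderiv ℝ p y (w y) + p y * divergence w y) = 0 := by
  have hwi : ∀ i, ContDiff ℝ 1 (fun y ↦ w y i) := fun i ↦ by fun_prop
  have hwis : ∀ i, HasCompactSupport (fun y ↦ w y i) := fun i ↦
    hws.comp_left (g := fun z : Space d ↦ z i) rfl
  have hpc : Continuous p := hp.continuous
  have hDp : Continuous (fderiv ℝ p) := hp.continuous_fderiv one_ne_zero
  have hDw : ∀ i, Continuous (fderiv ℝ (fun y ↦ w y i)) :=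
    fun i ↦ (hwi i).continuous_fderiv one_ne_zero
  have hcomp : ∀ i y v, fderiv ℝ (fun y ↦ w y i) y v = fderiv ℝ w y v i := by
    intro i y v
    have := ((EuclideanSpace.proj i : Space d →L[ℝ] ℝ).hasFDerivAt.comp y
      (hw.differentiable one_ne_zero y).hasFDerivAt).fderiv
    exact congrArg (fun L ↦ L v) this
  have hI1 : ∀ i, Integrable (fun y ↦ fderiv ℝ p y (EuclideanSpace.single i 1) * w y i) :=
    fun i ↦ Continuous.integrable_of_hasCompactSupport
      ((hDp.clm_apply continuous_const).mul (hwi i).continuous) (hwis i).mul_left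
  have hI2 : ∀ i, Integrable
      (fun y ↦ p y * fderiv ℝ (fun y ↦ w y i) y (EuclideanSpace.single i 1)) :=
    fun i ↦ Continuous.integrable_of_hasCompactSupport
      (hpc.mul ((hDw i).clm_apply continuous_const))
      (((hwis i).fderiv_apply (𝕜 := ℝ) _).mul_left)
  have hI3 : ∀ i, Integrable (fun y ↦ p y * w y i) :=
    fun i ↦ Continuous.integrable_of_hasCompactSupport (hpc.mul (hwi i).continuous)
      (hwis i).mul_left
  have hparts := fun i ↦ integral_mul_fderiv_eq_neg_fderiv_mul_of_integrable
    (hI1 i) (hI2 i) (hI3 i) (fun x _ ↦ hp.differentiable one_ne_zero x)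
    (fun x _ ↦ (hwi i).differentiable one_ne_zero x)
  have hsum : ∀ y, fderiv ℝ p y (w y) + p y * divergence w y =
      ∑ i, (fderiv ℝ p y (EuclideanSpace.single i 1) * w y i +
        p y * fderiv ℝ (fun y ↦ w y i) y (EuclideanSpace.single i 1)) := by
    intro y
    rw [Finset.sum_add_distrib, divergence, Finset.mul_sum]
    congr 1
    · conv_lhs => rw [sum_single_smul (w y)]
      simp [map_sum, mul_comm]
    · simp only [hcomp]
  simp only [hsum]
  have hI4 : ∀ i, Integrable (fun y ↦ fderiv ℝ p y (EuclideanSpace.single i 1) * w y i +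
      p y * fderiv ℝ (fun y ↦ w y i) y (EuclideanSpace.single i 1)) :=
    fun i ↦ (hI1 i).add (hI2 i)
  rw [integral_finsetSum _ fun i _ ↦ hI4 i]
  refine Finset.sum_eq_zero fun i _ ↦ ?_
  rw [integral_add (hI1 i) (hI2 i), hparts i]
  ring

theorem continuousOn_setIntegral {F : ℝ → Space d → ℝ} {T : ℝ} {Ω : Set (Space d)}
    (hΩ : MeasurableSet Ω) (hΩb : Bornology.IsBounded Ω)
    (hF : ContinuousOn (fun p : ℝ × Space d ↦ F p.1 p.2) (Icc 0 T ×ˢ closure Ω)) :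
    ContinuousOn (fun t ↦ ∫ x in Ω, F t x) (Icc 0 T) := by
  obtain ⟨B, hB⟩ := (isCompact_Icc.prod hΩb.isCompact_closure).exists_bound_of_continuousOn hF
  refine continuousOn_of_dominated (bound := fun _ ↦ B) (fun t ht ↦ ?_) (fun t ht ↦ ?_)
    (integrableOn_const hΩb.measure_lt_top.ne) ?_
  · exact (hF.comp (f := fun x ↦ (t, x)) (by fun_prop) fun x hx ↦
      ⟨ht, subset_closure hx⟩).aestronglyMeasurable hΩ
  · filter_upwards [ae_restrict_mem hΩ] with x hx
    exact hB (t, x) ⟨ht, subset_closure hx⟩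
  · filter_upwards [ae_restrict_mem hΩ] with x hx
    exact hF.comp (f := fun t ↦ (t, x)) (by fun_prop) fun t ht ↦ ⟨ht, subset_closure hx⟩

theorem integrableOn_of_continuousOn_closure {f : Space d → ℝ} {Ω : Set (Space d)}
    (hΩb : Bornology.IsBounded Ω) (hf : ContinuousOn f (closure Ω)) : IntegrableOn f Ω :=
  (hf.integrableOn_compact hΩb.isCompact_closure).mono_set subset_closure

theorem hasDerivAt_setIntegral {F F' : ℝ → Space d → ℝ} {T : ℝ} {Ω : Set (Space d)}
    (hΩ : MeasurableSet Ω) (hΩb : Bornology.IsBounded Ω)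
    (hF : ContinuousOn (fun p : ℝ × Space d ↦ F p.1 p.2) (Icc 0 T ×ˢ closure Ω))
    (hF' : ContinuousOn (fun p : ℝ × Space d ↦ F' p.1 p.2) (Icc 0 T ×ˢ closure Ω))
    (hder : ∀ x ∈ Ω, ∀ t ∈ Icc 0 T, HasDerivWithinAt (fun t ↦ F t x) (F' t x) (Icc 0 T) t)
    {t : ℝ} (ht : t ∈ Ioo 0 T) :
    HasDerivAt (fun t ↦ ∫ x in Ω, F t x) (∫ x in Ω, F' t x) t := by
  obtain ⟨B, hB⟩ := (isCompact_Icc.prod hΩb.isCompact_closure).exists_bound_of_continuousOn hF'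
  have hslice : ∀ {G : ℝ → Space d → ℝ},
      ContinuousOn (fun p : ℝ × Space d ↦ G p.1 p.2) (Icc 0 T ×ˢ closure Ω) →
      ∀ s ∈ Ioo 0 T, ContinuousOn (G s) (closure Ω) := fun hG s hs ↦
    hG.comp (f := fun x ↦ (s, x)) (by fun_prop) fun x hx ↦ ⟨Ioo_subset_Icc_self hs, hx⟩
  refine (hasDerivAt_integral_of_dominated_loc_of_deriv_le (s := Ioo 0 T)
    (bound := fun _ ↦ B) (isOpen_Ioo.mem_nhds ht) ?_
    (integrableOn_of_continuousOn_closure hΩb (hslice hF t ht))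
    (integrableOn_of_continuousOn_closure hΩb (hslice hF' t ht)).aestronglyMeasurable ?_
    (integrableOn_const hΩb.measure_lt_top.ne) ?_).2
  · filter_upwards [isOpen_Ioo.mem_nhds ht] with s hs
    exact (integrableOn_of_continuousOn_closure hΩb (hslice hF s hs)).aestronglyMeasurable
  · filter_upwards [ae_restrict_mem hΩ] with x hx s hs
    exact hB (s, x) ⟨Ioo_subset_Icc_self hs, subset_closure hx⟩
  · filter_upwards [ae_restrict_mem hΩ] with x hx s hs
    exact (hder x hx s (Ioo_subset_Icc_self hs)).hasDerivAt (Icc_mem_nhds hs.1 hs.2)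

/-! ### Pressure work and dispersion of the internal energy. -/

namespace ParticleFlow

variable {κ R T : ℝ} {I : Set ℝ} {c : ℝ → Space d → ℝ} {u Y : ℝ → Space d → Space d}

/-- The work of the pressure, in Lagrangian coordinates. -/
theorem setIntegral_pressure_work (hY : ParticleFlow R T c u Y) (h : ClassicalEuler κ I c u)
    (hκ : 0 < κ) (hTI : Icc 0 T ⊆ I) {Ω : Set (Space d)} (hΩ : IsOpen Ω)
    (hΩR : closure Ω ⊆ Metric.ball 0 R) (hc : ∀ x ∉ Ω, c 0 x = 0) (hc0 : ∀ x, 0 ≤ c 0 x)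
    {t : ℝ} (ht : t ∈ Icc 0 T) {w : Space d → Space d} (hw : ContDiff ℝ 1 w) :
    ∫ x in Ω, c 0 x ^ κ⁻¹ * (c t (Y t x) / κ * fderiv ℝ (c t) (Y t x) (w (Y t x)) +
      c t (Y t x) ^ 2 / (2 * κ + 1) * divergence w (Y t x)) = 0 := by
  have hΩb : Bornology.IsBounded Ω := Metric.isBounded_ball.subset (subset_closure.trans hΩR)
  have htI := hTI ht
  have hct : ContDiff ℝ 1 (c t) := contDiff_slice h.sound_C1 htI
  -- c^q is the pressure up to a constant: the density is c^(1/κ) and p is proportional to density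
  -- times c².
  set q : ℝ := κ⁻¹ + 2 with hq
  have hκi : 0 < κ⁻¹ := inv_pos.2 hκ
  have hq1 : (1 : ℝ) ≤ q := by linarith
  set p : Space d → ℝ := fun y ↦ c t y ^ q with hp
  have hpC : ContDiff ℝ 1 p :=
    (Real.contDiff_rpow_const_of_le (n := 1) (by simpa using hq1)).comp hct
  have hDp : ∀ y, fderiv ℝ p y = (q * c t y ^ (q - 1)) • fderiv ℝ (c t) y := fun y ↦
    ((hct.differentiable one_ne_zero y).hasFDerivAt.rpow_const (Or.inr hq1)).fderiv
  have hYc : Continuous (Y t) := by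
    obtain ⟨L, hL⟩ := hY.lipschitz t ht
    exact hL.continuous
  have hU : IsOpen (Y t '' Metric.ball 0 R) := by
    rw [isOpen_iff_mem_nhds]
    rintro _ ⟨x, hx, rfl⟩
    rw [← HasStrictFDerivAt.map_nhds_eq_of_equiv
      (f' := (fderiv ℝ (Y t) x).toContinuousLinearEquivOfDetNeZero (hY.det_pos t ht x).ne')
      (by simpa using hY.hasStrictFDerivAt t ht x)]
    exact image_mem_map (Metric.isOpen_ball.mem_nhds hx)
  obtain ⟨η, hηC, hηs, hηU, hη1⟩ := exists_cutoff (hΩb.isCompact_closure.image hYc) hU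
    (image_mono hΩR)
  have hzero := integral_fderiv_add_mul_divergence_eq_zero hpC (hηC.smul hw) hηs.smul_right
  -- Off the image of Ω the integrand vanishes: c = 0 on the rest of the image of the ball, and the
  -- cut-off vanishes beyond it.
  rw [← setIntegral_eq_integral_of_forall_compl_eq_zero (s := Y t '' Ω)] at hzero
  swap
  · intro y hy
    by_cases hyU : y ∈ Y t '' Metric.ball 0 R
    · obtain ⟨x, hx, rfl⟩ := hyU
      have hxΩ : x ∉ Ω := fun hx' ↦ hy ⟨x, hx', rfl⟩
      have hcz : c t (Y t x) = 0 := by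
        rw [hY.sound_eq h hTI (by simpa using hx) ht, hc x hxΩ, zero_mul]
      rw [hDp, hp]
      simp only [hcz]
      rw [Real.zero_rpow (by linarith), Real.zero_rpow (by linarith)]
      simp
    · have hyη := notMem_tsupport_iff_eventuallyEq.1 fun h' ↦ hyU (hηU h')
      have hz : (η • w) =ᶠ[𝓝 y] fun _ ↦ 0 := by
        filter_upwards [hyη] with z hz
        rw [Pi.smul_apply', hz, Pi.zero_apply, zero_smul]
      simp only [divergence, hz.fderiv_eq, hz.self_of_nhds]
      simp
  have hcov := integral_image_eq_integral_abs_det_fderiv_smul volume hΩ.measurableSet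
    (fun x _ ↦ (hY.hasStrictFDerivAt t ht x).hasFDerivAt.hasFDerivWithinAt)
    (hY.injective t ht).injOn
    (fun y ↦ fderiv ℝ p y ((η • w) y) + p y * divergence (η • w) y)
  rw [hzero] at hcov
  have hγ : 0 < 2 * κ + 1 := by linarith
  rw [← mul_right_inj' hγ.ne', mul_zero, ← integral_const_mul]
  refine Eq.trans ?_ hcov.symm
  refine setIntegral_congr_fun hΩ.measurableSet fun x hx ↦ ?_
  have hxR : ‖x‖ < R := by simpa using hΩR (subset_closure hx)
  have hz : (η • w) =ᶠ[𝓝 (Y t x)] w := by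
    filter_upwards [hη1 _ ⟨x, subset_closure hx, rfl⟩] with z hz
    rw [Pi.smul_apply', hz, one_smul]
  have hdet := hY.det_pos t ht x
  have hcx := hY.sound_eq h hTI hxR ht
  set D := (fderiv ℝ (Y t) x).det with hD
  have hcpos : 0 ≤ c t (Y t x) := by
    rw [hcx]
    exact mul_nonneg (hc0 x) (Real.rpow_nonneg hdet.le _)
  have hρ : D * c t (Y t x) ^ κ⁻¹ = c 0 x ^ κ⁻¹ := by
    rw [hcx, Real.mul_rpow (hc0 x) (Real.rpow_nonneg hdet.le _), ← Real.rpow_mul hdet.le,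
      neg_mul, mul_inv_cancel₀ hκ.ne', Real.rpow_neg_one]
    field_simp
  simp only [divergence, hz.fderiv_eq, hz.self_of_nhds, hDp, abs_of_pos hdet, smul_apply,
    smul_eq_mul]
  have hpx : p (Y t x) = c t (Y t x) ^ q := rfl
  have e1 : c t (Y t x) ^ (q - 1) = c t (Y t x) ^ κ⁻¹ * c t (Y t x) := by
    rw [hq, show κ⁻¹ + 2 - 1 = κ⁻¹ + 1 by ring,
      Real.rpow_add_one' hcpos (by positivity)]
  have e2 : c t (Y t x) ^ q = c t (Y t x) ^ κ⁻¹ * c t (Y t x) ^ 2 := by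
    rw [hq, Real.rpow_add' hcpos (by positivity), Real.rpow_two]
  rw [hpx, e1, e2, ← hρ, hq]
  field_simp
  ring

end ParticleFlow

theorem divergence_smul_id_sub_smul {v : Space d → Space d} (hv : Differentiable ℝ v) (a b : ℝ)
    (y : Space d) : divergence (fun y ↦ a • y - b • v y) y = a * d - b * divergence v y := by
  have : fderiv ℝ (fun y ↦ a • y - b • v y) y =
      a • ContinuousLinearMap.id ℝ (Space d) - b • fderiv ℝ v y :=
    (((hasFDerivAt_id y).const_smul a).sub ((hv y).hasFDerivAt.const_smul b)).fderiv
  simp only [divergence, this]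
  simp [Finset.sum_sub_distrib, Finset.mul_sum, mul_comm]

namespace ParticleFlow

variable {κ R T : ℝ} {I : Set ℝ} {c : ℝ → Space d → ℝ} {u Y : ℝ → Space d → Space d}

/-- The dispersion estimate for the internal energy. -/
theorem dispersion (hY : ParticleFlow R T c u Y) (h : ClassicalEuler κ I c u)
    (hκ : 0 < κ) (hT : 0 ≤ T) (hTI : Icc 0 T ⊆ I) {Ω : Set (Space d)} (hΩ : IsOpen Ω)
    (hΩR : closure Ω ⊆ Metric.ball 0 R) (hc : ∀ x ∉ Ω, c 0 x = 0) (hc0 : ∀ x, 0 ≤ c 0 x)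
    {t : ℝ} (ht : t ∈ Icc 0 T) :
    (1 + t) ^ (min 2 (2 * κ * d)) * ∫ x in Ω, c 0 x ^ κ⁻¹ * c t (Y t x) ^ 2 ≤
      2 * κ * (2 * κ + 1) * ∫ x in Ω, c 0 x ^ κ⁻¹ *
        (‖x - u 0 x‖ ^ 2 / 2 + c 0 x ^ 2 / (2 * κ * (2 * κ + 1))) := by
  have hΩb : Bornology.IsBounded Ω := Metric.isBounded_ball.subset (subset_closure.trans hΩR)
  have hΩm := hΩ.measurableSet
  set A : ℝ := 2 * κ * (2 * κ + 1) with hA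
  have hA0 : 0 < A := by positivity
  set ρ : Space d → ℝ := fun x ↦ c 0 x ^ κ⁻¹ with hρ
  have hρ0 : ∀ x, 0 ≤ ρ x := fun x ↦ Real.rpow_nonneg (hc0 x) _
  have hρc : Continuous ρ := (contDiff_slice h.sound_C1 (hTI ⟨le_rfl, hT⟩)).continuous.rpow_const
    fun x ↦ Or.inr (inv_nonneg.2 hκ.le)
  have hYc : ContinuousOn (fun p : ℝ × Space d ↦ Y p.1 p.2) (Icc 0 T ×ˢ closure Ω) :=
    hY.continuousOn.mono (prod_mono_right (subset_univ _))
  have hΓ : ContinuousOn (fun p : ℝ × Space d ↦ (p.1, Y p.1 p.2)) (Icc 0 T ×ˢ closure Ω) :=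
    continuousOn_fst.prodMk hYc
  have hΓm : MapsTo (fun p : ℝ × Space d ↦ (p.1, Y p.1 p.2)) (Icc 0 T ×ˢ closure Ω)
    (I ×ˢ univ) := fun p hp ↦ ⟨hTI hp.1, mem_univ _⟩
  have hcc : ContinuousOn (fun p : ℝ × Space d ↦ c p.1 (Y p.1 p.2)) (Icc 0 T ×ˢ closure Ω) :=
    h.sound_C1.continuousOn.comp hΓ hΓm
  have huc : ContinuousOn (fun p : ℝ × Space d ↦ u p.1 (Y p.1 p.2)) (Icc 0 T ×ˢ closure Ω) :=
    h.velocity_C1.continuousOn.comp hΓ hΓm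
  have hDc : ContinuousOn (fun p : ℝ × Space d ↦ fderiv ℝ (c p.1) (Y p.1 p.2))
      (Icc 0 T ×ˢ closure Ω) := (continuousOn_fderiv_slice h.isOpen h.sound_C1).comp hΓ hΓm
  have hdiv : ContinuousOn (fun p : ℝ × Space d ↦ divergence (u p.1) (Y p.1 p.2))
      (Icc 0 T ×ˢ closure Ω) := continuous_traceOf.comp_continuousOn
    ((continuousOn_fderiv_slice h.isOpen h.velocity_C1).comp hΓ hΓm)
  have hρc' : ContinuousOn (fun p : ℝ × Space d ↦ ρ p.2) (Icc 0 T ×ˢ closure Ω) :=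
    (hρc.comp continuous_snd).continuousOn
  have hτc : ContinuousOn (fun p : ℝ × Space d ↦ 1 + p.1) (Icc 0 T ×ˢ closure Ω) := by fun_prop
  have hMc : ContinuousOn (fun p : ℝ × Space d ↦ Y p.1 p.2 - (1 + p.1) • u p.1 (Y p.1 p.2))
      (Icc 0 T ×ˢ closure Ω) := hYc.sub (hτc.smul huc)
  set e : ℝ → Space d → ℝ := fun t x ↦ ρ x * c t (Y t x) ^ 2 with he
  have hec : ContinuousOn (fun p : ℝ × Space d ↦ e p.1 p.2) (Icc 0 T ×ˢ closure Ω) :=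
    hρc'.mul (hcc.pow 2)
  -- Kinetic energy of Y - (1+t)u plus (1+t)² times the internal energy, where A = γ(γ-1). In the
  -- time derivative of Y - (1+t)u the velocity cancels and only the pressure is left. The shift to
  -- 1 + t keeps the weight (1+t)^(m-2) regular at t = 0.
  set F : ℝ → Space d → ℝ := fun t x ↦ ρ x * (‖Y t x - (1 + t) • u t (Y t x)‖ ^ 2 / 2 +
    (1 + t) ^ 2 * (c t (Y t x) ^ 2 / A)) with hF
  have hFc : ContinuousOn (fun p : ℝ × Space d ↦ F p.1 p.2) (Icc 0 T ×ˢ closure Ω) :=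
    hρc'.mul (((hMc.norm.pow 2).div_const 2).add ((hτc.pow 2).mul ((hcc.pow 2).div_const A)))
  set F' : ℝ → Space d → ℝ := fun t x ↦ ρ x * ((1 + t) * (c t (Y t x) / κ *
    fderiv ℝ (c t) (Y t x) (Y t x - (1 + t) • u t (Y t x))) + 2 * (1 + t) * (c t (Y t x) ^ 2 / A) -
    (1 + t) ^ 2 * (c t (Y t x) ^ 2 / (2 * κ + 1) * divergence (u t) (Y t x))) with hF'
  have hF'c : ContinuousOn (fun p : ℝ × Space d ↦ F' p.1 p.2) (Icc 0 T ×ˢ closure Ω) :=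
    hρc'.mul (((hτc.mul ((hcc.div_const κ).mul (hDc.clm_apply hMc))).add
      ((hτc.const_mul 2).mul ((hcc.pow 2).div_const A))).sub
      ((hτc.pow 2).mul (((hcc.pow 2).div_const (2 * κ + 1)).mul hdiv)))
  have hder : ∀ x ∈ Ω, ∀ t ∈ Icc 0 T,
      HasDerivWithinAt (fun t ↦ F t x) (F' t x) (Icc 0 T) t := by
    intro x hx s hs
    have hxR : ‖x‖ < R := by simpa using hΩR (subset_closure hx)
    have dY := hY.hasDerivWithinAt x hxR s hs
    have du : HasDerivWithinAt (fun τ ↦ u τ (Y τ x))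
        (-((c s (Y s x) / κ) • gradient (c s) (Y s x))) (Icc 0 T) s :=
      (hasDerivWithinAt_along h.isOpen h.velocity_C1 (hTI hs) dY).congr_deriv
        (eq_neg_of_add_eq_zero_left (h.velocity_eq s (hTI hs) (Y s x)))
    have dc : HasDerivWithinAt (fun τ ↦ c τ (Y τ x))
        (-(κ * c s (Y s x) * divergence (u s) (Y s x))) (Icc 0 T) s :=
      (hasDerivWithinAt_along h.isOpen h.sound_C1 (hTI hs) dY).congr_deriv
        (eq_neg_of_add_eq_zero_left (h.sound_eq s (hTI hs) (Y s x)))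
    have dτ : HasDerivWithinAt (fun τ : ℝ ↦ 1 + τ) 1 (Icc 0 T) s :=
      (hasDerivWithinAt_id s _).const_add 1
    have dM : HasDerivWithinAt (fun τ ↦ ‖Y τ x - (1 + τ) • u τ (Y τ x)‖ ^ 2)
        (2 * ((1 + s) * (c s (Y s x) / κ) *
          fderiv ℝ (c s) (Y s x) (Y s x - (1 + s) • u s (Y s x)))) (Icc 0 T) s := by
      refine (dY.sub (dτ.smul du)).norm_sq.congr_deriv ?_
      have hM' : u s (Y s x) - ((1 + s) • -((c s (Y s x) / κ) • gradient (c s) (Y s x)) +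
          (1 : ℝ) • u s (Y s x)) = ((1 + s) * (c s (Y s x) / κ)) • gradient (c s) (Y s x) := by
        rw [one_smul, smul_neg, smul_smul]
        abel
      rw [hM', inner_smul_right, real_inner_comm, inner_gradient_left]
      rfl
    have := ((dM.div_const 2).add ((dτ.pow 2).mul ((dc.pow 2).div_const A))).const_mul (ρ x)
    refine this.congr_deriv ?_
    simp only [hF', hA, Pi.pow_apply]
    field_simp
    simp
    ring
  set E : ℝ → ℝ := fun t ↦ ∫ x in Ω, e t x with hE
  set J : ℝ → ℝ := fun t ↦ ∫ x in Ω, F t x with hJ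
  have hslice : ∀ {G : ℝ → Space d → ℝ},
      ContinuousOn (fun p : ℝ × Space d ↦ G p.1 p.2) (Icc 0 T ×ˢ closure Ω) →
      ∀ s ∈ Icc 0 T, IntegrableOn (G s) Ω := fun hG s hs ↦
    integrableOn_of_continuousOn_closure hΩb
      (hG.comp (f := fun x ↦ (s, x)) (by fun_prop) fun x hx ↦ ⟨hs, hx⟩)
  have hE0 : ∀ s, 0 ≤ E s := fun s ↦ integral_nonneg fun x ↦ mul_nonneg (hρ0 x) (sq_nonneg _)
  have hJ' : ∀ s ∈ Icc 0 T, ∫ x in Ω, F' s x = (1 + s) * (2 - 2 * κ * d) / A * E s := by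
    intro s hs
    have hus := contDiff_slice h.velocity_C1 (hTI hs)
    -- For this w the work contains exactly the ∇c and div u terms of F'; only the divergence d of
    -- the identity survives, whence 2 - 2κd.
    have hwork := hY.setIntegral_pressure_work h hκ hTI hΩ hΩR hc hc0 hs
      (w := fun y ↦ (1 + s) • y - (1 + s) ^ 2 • u s y) (by fun_prop)
    rw [← sub_eq_zero, hE, ← integral_const_mul, ← integral_sub (hslice hF'c s hs)
      ((hslice hec s hs).const_mul _), ← hwork]
    refine integral_congr_ae (Eventually.of_forall fun x ↦ ?_)
    simp only [hF', he, hA, divergence_smul_id_sub_smul (hus.differentiable one_ne_zero),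
      map_sub, map_smul, smul_eq_mul, hρ]
    field_simp
    ring
  have hJE : ∀ s ∈ Icc 0 T, (1 + s) ^ 2 / A * E s ≤ J s := by
    intro s hs
    rw [hE, ← integral_const_mul]
    refine integral_mono ((hslice hec s hs).const_mul _) (hslice hFc s hs) fun x ↦ ?_
    have : 0 ≤ ρ x * (‖Y s x - (1 + s) • u s (Y s x)‖ ^ 2 / 2) :=
      mul_nonneg (hρ0 x) (by positivity)
    simp only [hF, he]
    calc _ = ρ x * ((1 + s) ^ 2 * (c s (Y s x) ^ 2 / A)) := by ring
      _ ≤ _ := by rw [mul_add]; linarith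
  set m : ℝ := min 2 (2 * κ * d) with hm
  have hJd : ∀ s ∈ Ioo 0 T, HasDerivAt (fun s ↦ (1 + s) ^ (m - 2) * J s)
      (1 * (m - 2) * (1 + s) ^ (m - 2 - 1) * J s +
        (1 + s) ^ (m - 2) * ((1 + s) * (2 - 2 * κ * d) / A * E s)) s := by
    intro s hs
    have h1 : HasDerivAt (fun τ : ℝ ↦ 1 + τ) 1 s := (hasDerivAt_id s).const_add 1
    have h2 := hasDerivAt_setIntegral hΩm hΩb hFc hF'c hder hs
    rw [hJ' s (Ioo_subset_Icc_self hs)] at h2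
    exact (h1.rpow_const (p := m - 2) (Or.inl (by linarith [hs.1]))).mul h2
  have hanti : AntitoneOn (fun s ↦ (1 + s) ^ (m - 2) * J s) (Icc 0 T) := by
    refine antitoneOn_of_deriv_nonpos (convex_Icc 0 T) ?_ ?_ ?_
    · refine ContinuousOn.mul (ContinuousOn.rpow_const (by fun_prop) fun s hs ↦ Or.inl ?_)
        (continuousOn_setIntegral hΩm hΩb hFc)
      linarith [hs.1]
    · rw [interior_Icc]
      exact fun s hs ↦ (hJd s hs).differentiableAt.differentiableWithinAt
    · rw [interior_Icc]
      intro s hs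
      have hs' := Ioo_subset_Icc_self hs
      have hτ : 0 < 1 + s := by linarith [hs.1]
      rw [(hJd s hs).deriv]
      have hsplit : (1 + s) ^ (m - 2) = (1 + s) ^ (m - 2 - 1) * (1 + s) := by
        rw [← Real.rpow_add_one hτ.ne']
        ring_nf
      have hfac : 1 * (m - 2) * (1 + s) ^ (m - 2 - 1) * J s +
          (1 + s) ^ (m - 2) * ((1 + s) * (2 - 2 * κ * d) / A * E s) =
          (1 + s) ^ (m - 2 - 1) * ((m - 2) * J s +
            (2 - 2 * κ * d) * ((1 + s) ^ 2 / A * E s)) := by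
        rw [hsplit]
        ring
      rw [hfac]
      refine mul_nonpos_of_nonneg_of_nonpos (Real.rpow_nonneg hτ.le _) ?_
      have hm2 : m ≤ 2 := min_le_left _ _
      have hmd : m ≤ 2 * κ * d := min_le_right _ _
      have hP : 0 ≤ (1 + s) ^ 2 / A * E s := mul_nonneg (by positivity) (hE0 s)
      -- With P = (1+s)²E/A ≤ J, the bracket is (m-2)(J-P) + (m-2κd)P, and both terms are
      -- nonpositive.
      nlinarith [hJE s hs', mul_nonneg (sub_nonneg.2 hm2) (sub_nonneg.2 (hJE s hs')),
        mul_nonneg (sub_nonneg.2 hmd) hP]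
  have hfinal := hanti (left_mem_Icc.2 hT) ht ht.1
  have hJ0 : J 0 = ∫ x in Ω, ρ x * (‖x - u 0 x‖ ^ 2 / 2 + c 0 x ^ 2 / A) := by
    simp only [hJ, hF, hY.init, add_zero, one_smul, one_pow, one_mul]
  have hτ : 0 < 1 + t := by linarith [ht.1]
  simp only [add_zero, Real.one_rpow, one_mul] at hfinal
  rw [hJ0] at hfinal
  have hlow : (1 + t) ^ (m - 2) * ((1 + t) ^ 2 / A * E t) ≤ (1 + t) ^ (m - 2) * J t :=
    mul_le_mul_of_nonneg_left (hJE t ht) (Real.rpow_nonneg hτ.le _)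
  have hcomb : (1 + t) ^ (m - 2) * ((1 + t) ^ 2 / A * E t) = (1 + t) ^ m * E t / A := by
    have : (1 + t) ^ m = (1 + t) ^ (m - 2) * (1 + t) ^ 2 := by
      rw [← Real.rpow_natCast, ← Real.rpow_add hτ]
      norm_num
    rw [this]
    ring
  rw [hcomb] at hlow
  have := (div_le_iff₀' hA0).1 (hlow.trans hfinal)
  exact this

end ParticleFlow

/-! ### Lower bound for the internal energy, and conclusion. -/

/-- The convex function x ↦ x^(-k) lies above its tangent at 1. -/
theorem one_add_sub_mul_le_rpow_neg {x k : ℝ} (hx : 0 < x) (hk : 0 ≤ k) :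
    1 + k - k * x ≤ x ^ (-k) := by
  rw [Real.rpow_def_of_pos hx]
  have h1 := Real.add_one_le_exp (Real.log x * -k)
  have h2 := Real.log_le_sub_one_of_pos hx
  nlinarith

/-- Jensen's inequality in explicit form: integrate the tangent inequality at D = l, replacing g by
G in the term linear in D. -/
theorem le_integral_mul_rpow_neg {α : Type*} [MeasurableSpace α] {μ : Measure α} {g D : α → ℝ}
    {G W k : ℝ} (hk : 0 ≤ k) (hG : 0 < G) (hW : 0 < W) (hg0 : ∀ᵐ x ∂μ, 0 ≤ g x)
    (hgG : ∀ᵐ x ∂μ, g x ≤ G) (hD : ∀ᵐ x ∂μ, 0 < D x) (hgi : Integrable g μ)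
    (hDi : Integrable D μ) (hgDi : Integrable (fun x ↦ g x * D x ^ (-k)) μ)
    (hm : 0 < ∫ x, g x ∂μ) (hDW : ∫ x, D x ∂μ ≤ W) :
    (∫ x, g x ∂μ) * (G * W / ∫ x, g x ∂μ) ^ (-k) ≤ ∫ x, g x * D x ^ (-k) ∂μ := by
  set m := ∫ x, g x ∂μ with hmdef
  -- Chosen so that (kG/l) W = k m; then (1+k)m - km = m remains.
  set l : ℝ := G * W / m with hl
  have hl0 : 0 < l := by positivity
  have hlk : 0 ≤ l ^ (-k) := Real.rpow_nonneg hl0.le _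
  have hpt : ∀ᵐ x ∂μ, l ^ (-k) * ((1 + k) * g x - k * G / l * D x) ≤ g x * D x ^ (-k) := by
    filter_upwards [hg0, hgG, hD] with x h0 h1 h2
    have h3 := one_add_sub_mul_le_rpow_neg (div_pos h2 hl0) hk
    have h4 : D x ^ (-k) = l ^ (-k) * (D x / l) ^ (-k) := by
      rw [← Real.mul_rpow hl0.le (by positivity), mul_div_cancel₀ _ hl0.ne']
    rw [h4, mul_left_comm]
    refine mul_le_mul_of_nonneg_left ?_ hlk
    have h5 : k * (g x * (D x / l)) ≤ k * (G * (D x / l)) := by gcongr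
    calc (1 + k) * g x - k * G / l * D x = (1 + k) * g x - k * (G * (D x / l)) := by ring
      _ ≤ g x * (1 + k - k * (D x / l)) := by linarith
      _ ≤ _ := mul_le_mul_of_nonneg_left h3 h0
  refine le_trans ?_ (integral_mono_ae
    (((hgi.const_mul (1 + k)).sub (hDi.const_mul (k * G / l))).const_mul _) hgDi hpt)
  rw [integral_const_mul, integral_sub' (hgi.const_mul _) (hDi.const_mul _), integral_const_mul,
    integral_const_mul, mul_comm]
  refine mul_le_mul_of_nonneg_left ?_ hlk
  have h6 : k * G / l * ∫ x, D x ∂μ ≤ k * G / l * W := by gcongr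
  have h7 : k * G / l * W = k * m := by
    rw [hl]
    field_simp
  linarith

/-- If the vacuum problem with `J ≤ 0` has a solution up to time `t ≥ 1`, then a power of `t` is
bounded in terms of the data. -/
theorem exists_rpow_le_of_classicalEuler {κ : ℝ} (hκ : 0 < κ) {c₀ : Space d → ℝ}
    {u₀ : Space d → Space d} (hc₀ : Continuous c₀) (hu₀ : ContDiff ℝ 1 u₀)
    (hc₀_nonneg : ∀ x, 0 ≤ c₀ x) (hc₀_ne : c₀ ≠ 0) {Ω : Set (Space d)} (hΩ : IsOpen Ω)
    (hΩb : Bornology.IsBounded Ω) (hc₀Ω : Function.support c₀ ⊆ Ω)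
    (hJ : ∫ x in Ω, (fderiv ℝ u₀ x).det ≤ 0) :
    ∃ C : ℝ, ∀ (t : ℝ) (I : Set ℝ) (c : ℝ → Space d → ℝ) (u : ℝ → Space d → Space d),
      1 ≤ t → Icc 0 t ⊆ I → ClassicalEuler κ I c u → c 0 = c₀ → u 0 = u₀ →
        t ^ (min 2 (2 * κ * d) - 2 * κ * (d - 1)) ≤ C := by
  obtain ⟨R, hR, hΩR⟩ : ∃ R : ℝ, 0 < R ∧ closure Ω ⊆ Metric.ball 0 R := by
    obtain ⟨R, hR⟩ := hΩb.closure.subset_ball 0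
    exact ⟨max R 1, by positivity, hR.trans (Metric.ball_subset_ball (le_max_left _ _))⟩
  obtain ⟨C₁, hC₁, hgrow⟩ := exists_setIntegral_det_one_add_smul_le hu₀ hΩ.measurableSet hΩb
  set g : Space d → ℝ := fun x ↦ c₀ x ^ κ⁻¹ * c₀ x ^ 2 with hg
  have hgc : Continuous g :=
    (hc₀.rpow_const fun x ↦ Or.inr (inv_nonneg.2 hκ.le)).mul (hc₀.pow 2)
  have hg0 : ∀ x, 0 ≤ g x := fun x ↦
    mul_nonneg (Real.rpow_nonneg (hc₀_nonneg x) _) (sq_nonneg _)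
  have hgi : IntegrableOn g Ω := integrableOn_of_continuousOn_closure hΩb hgc.continuousOn
  obtain ⟨G, hG⟩ := hΩb.isCompact_closure.exists_bound_of_continuousOn hgc.continuousOn
  have hm : 0 < ∫ x in Ω, g x := by
    rw [setIntegral_pos_iff_support_of_nonneg_ae (Eventually.of_forall hg0) hgi]
    obtain ⟨x, hx⟩ := Function.ne_iff.1 hc₀_ne
    rw [Pi.zero_apply] at hx
    refine (hgc.isOpen_support.inter hΩ).measure_pos volume ⟨x, ?_, hc₀Ω hx⟩
    have : 0 < c₀ x := lt_of_le_of_ne (hc₀_nonneg x) hx.symm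
    exact (mul_pos (Real.rpow_pos_of_pos this _) (pow_pos this 2)).ne'
  set m := ∫ x in Ω, g x with hmdef
  set E₀ : ℝ := 2 * κ * (2 * κ + 1) * ∫ x in Ω, c₀ x ^ κ⁻¹ *
    (‖x - u₀ x‖ ^ 2 / 2 + c₀ x ^ 2 / (2 * κ * (2 * κ + 1))) with hE₀
  set G' : ℝ := |G| + 1 with hG'
  have hG'0 : 0 < G' := by positivity
  set B : ℝ := G' * (C₁ + 1) / m with hB
  have hB0 : 0 < B := by positivity
  refine ⟨E₀ / (m * B ^ (-(2 * κ))), fun t I c u ht hTI h hc0 hu0 ↦ ?_⟩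
  subst hc0 hu0
  have ht0 : 0 < t := by linarith
  have hcΩ : ∀ x ∉ Ω, c 0 x = 0 := fun x hx ↦ by
    by_contra hne
    exact hx (hc₀Ω hne)
  obtain ⟨Y, hY⟩ := h.exists_particleFlow hκ ht0.le hTI hR fun x hx ↦ hcΩ x fun hx' ↦ by
    have := hΩR (subset_closure hx')
    rw [mem_ball_zero_iff] at this
    exact this.ne hx
  have htt : t ∈ Icc 0 t := right_mem_Icc.2 ht0.le
  have hdisp := hY.dispersion h hκ ht0.le hTI hΩ hΩR hcΩ hc₀_nonneg htt
  rw [← hE₀] at hdisp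
  obtain ⟨L, hL⟩ := hY.lipschitz t htt
  have hYd : Differentiable ℝ (Y t) := fun x ↦ (hY.hasStrictFDerivAt t htt x).differentiableAt
  have hDi : IntegrableOn (fun x ↦ (fderiv ℝ (Y t) x).det) Ω := by
    obtain ⟨K, hK⟩ := (isCompact_closedBall (0 : Space d →L[ℝ] Space d)
      L).exists_bound_of_continuousOn ContinuousLinearMap.continuous_det.continuousOn
    refine Measure.integrableOn_of_bounded (M := K) hΩb.measure_lt_top.ne
      (ContinuousLinearMap.continuous_det.measurable.comp
        (measurable_fderiv ℝ (Y t))).aestronglyMeasurable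
      (Eventually.of_forall fun x ↦ hK _ ?_)
    rw [mem_closedBall_zero_iff]
    exact norm_fderiv_le_of_lipschitz ℝ hL
  -- The sign of J enters here: it discards the t^d term.
  have hDW : ∫ x in Ω, (fderiv ℝ (Y t) x).det ≤ (C₁ + 1) * t ^ ((d : ℝ) - 1) := by
    rw [hY.setIntegral_det_eq hu₀ hΩ hΩR hcΩ htt]
    refine (hgrow t ht).trans ?_
    rw [Real.rpow_sub_one ht0.ne', Real.rpow_natCast]
    have : (∫ x in Ω, (fderiv ℝ (u 0) x).det) + C₁ / t ≤ (C₁ + 1) / t := by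
      rw [add_div]
      linarith [one_div_pos.2 ht0]
    calc _ ≤ t ^ d * ((C₁ + 1) / t) := by gcongr
      _ = _ := by ring
  have hcong : ∀ x ∈ Ω, c 0 x ^ κ⁻¹ * c t (Y t x) ^ 2 =
      g x * (fderiv ℝ (Y t) x).det ^ (-(2 * κ)) := by
    intro x hx
    have hxR : ‖x‖ < R := by simpa using hΩR (subset_closure hx)
    rw [hY.sound_eq h hTI hxR htt, hg, mul_pow, ← Real.rpow_natCast (_ ^ (-κ)),
      ← Real.rpow_mul (hY.det_pos t htt x).le, mul_assoc]
    congr 3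
    push_cast
    ring
  have hgDi : IntegrableOn (fun x ↦ g x * (fderiv ℝ (Y t) x).det ^ (-(2 * κ))) Ω := by
    refine IntegrableOn.congr_fun ?_ hcong hΩ.measurableSet
    exact integrableOn_of_continuousOn_closure hΩb
      (((hc₀.rpow_const fun x ↦ Or.inr (inv_nonneg.2 hκ.le)).mul
        (((contDiff_slice h.sound_C1 (hTI htt)).continuous.comp hL.continuous).pow 2)).continuousOn)
  have hlow := le_integral_mul_rpow_neg (k := 2 * κ) (G := G')
    (W := (C₁ + 1) * t ^ ((d : ℝ) - 1)) (by positivity) hG'0 (by positivity)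
    (Eventually.of_forall hg0) (by
      filter_upwards [ae_restrict_mem hΩ.measurableSet] with x hx
      have := hG x (subset_closure hx)
      rw [Real.norm_of_nonneg (hg0 x)] at this
      linarith [le_abs_self G]) (Eventually.of_forall (hY.det_pos t htt)) hgi hDi hgDi hm hDW
  rw [← setIntegral_congr_fun hΩ.measurableSet hcong, ← hmdef] at hlow
  have hsplit : (G' * ((C₁ + 1) * t ^ ((d : ℝ) - 1)) / m) ^ (-(2 * κ)) =
      B ^ (-(2 * κ)) * t ^ (-(2 * κ * ((d : ℝ) - 1))) := by
    rw [show G' * ((C₁ + 1) * t ^ ((d : ℝ) - 1)) / m = B * t ^ ((d : ℝ) - 1) by rw [hB]; ring,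
      Real.mul_rpow hB0.le (Real.rpow_nonneg ht0.le _), ← Real.rpow_mul ht0.le]
    congr 2
    ring
  rw [hsplit] at hlow
  have hBp : 0 < B ^ (-(2 * κ)) := Real.rpow_pos_of_pos hB0 _
  rw [le_div_iff₀ (by positivity)]
  have hμ0 : 0 ≤ min 2 (2 * κ * (d : ℝ)) := by positivity
  calc t ^ (min 2 (2 * κ * d) - 2 * κ * ((d : ℝ) - 1)) * (m * B ^ (-(2 * κ)))
      = t ^ (min 2 (2 * κ * (d : ℝ))) *
          (m * (B ^ (-(2 * κ)) * t ^ (-(2 * κ * ((d : ℝ) - 1))))) := by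
        rw [sub_eq_add_neg, Real.rpow_add ht0]
        ring
    _ ≤ (1 + t) ^ (min 2 (2 * κ * (d : ℝ))) *
          (m * (B ^ (-(2 * κ)) * t ^ (-(2 * κ * ((d : ℝ) - 1))))) := by
        gcongr
        linarith
    _ ≤ (1 + t) ^ (min 2 (2 * κ * (d : ℝ))) * ∫ x in Ω, c 0 x ^ κ⁻¹ * c t (Y t x) ^ 2 := by
        gcongr
    _ ≤ E₀ := hdisp

end VacuumEuler

theorem mainTheorem3 (d : ℕ) (hd : 1 ≤ d) (γ s : ℝ) (hγ : 1 < γ)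
    (hγd : (γ - 1) * ((d : ℝ) - 1) ≤ 1) (hs : 1 + (d : ℝ) / 2 < s)
    (c₀ : VacuumEuler.Space d → ℝ) (u₀ : VacuumEuler.Space d → VacuumEuler.Space d)
    (hc₀ : VacuumEuler.MemHs s c₀) (hu₀ : ∀ i, VacuumEuler.MemHs s (fun x ↦ u₀ x i))
    (hc₀_nonneg : ∀ x, 0 ≤ c₀ x) (hc₀_ne : c₀ ≠ 0)
    (Ω : Set (VacuumEuler.Space d)) (hΩ_open : IsOpen Ω) (hΩ_bdd : Bornology.IsBounded Ω)
    (hc₀Ω : Function.support c₀ ⊆ Ω)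
    (hJ : (∫ x in Ω, (fderiv ℝ u₀ x).det) ≤ 0) :
    VacuumEuler.maximalTime γ s c₀ u₀ < ⊤ := by
  rw [lt_top_iff_ne_top]
  intro htop
  rw [VacuumEuler.maximalTime, sSup_eq_top] at htop
  -- The solution may depend on t. No uniqueness is needed, because the final bound depends on the
  -- data only.
  have hsol : ∀ t : ℝ, ∃ S T : ℝ, 0 < S ∧ 0 < T ∧ t < T ∧
      ∃ c u, VacuumEuler.IsSmoothSolution γ s (Ioo (-S) T) c₀ u₀ c u := by
    intro t
    obtain ⟨_, ⟨S, T, hS, hT, rfl, c, u, h⟩, hlt⟩ :=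
      htop (ENNReal.ofReal t) ENNReal.ofReal_lt_top
    exact ⟨S, T, hS, hT, (ENNReal.ofReal_lt_ofReal_iff hT).1 hlt, c, u, h⟩
  have hκ : 0 < (γ - 1) / 2 := by linarith
  have hu₀C : ContDiff ℝ 1 u₀ := by
    obtain ⟨S, T, hS, hT, -, c, u, h⟩ := hsol 0
    rw [← h.velocity_init]
    exact VacuumEuler.contDiff_slice h.velocity_C1 ⟨by linarith, hT⟩
  obtain ⟨C, hC⟩ := VacuumEuler.exists_rpow_le_of_classicalEuler hκ hc₀.1 hu₀C hc₀_nonneg hc₀_ne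
    hΩ_open hΩ_bdd hc₀Ω hJ
  -- For the entry 2 of the minimum, 2κ(d-1) = (γ-1)(d-1) ≤ 1 < 2; for the entry 2κd, the gap is 2κ
  -- > 0.
  have hδ : 0 < min 2 (2 * ((γ - 1) / 2) * (d : ℝ)) - 2 * ((γ - 1) / 2) * ((d : ℝ) - 1) := by
    rw [sub_pos, lt_min_iff]
    constructor <;> nlinarith
  obtain ⟨t, htC, ht1⟩ := ((tendsto_rpow_atTop hδ).eventually_gt_atTop C |>.and
    (Filter.eventually_ge_atTop 1)).exists
  obtain ⟨S, T, hS, hT, htT, c, u, h⟩ := hsol t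
  exact absurd (hC t (Ioo (-S) T) c u ht1
    (fun r hr ↦ ⟨by linarith [hr.1], by linarith [hr.2]⟩)
    (h.classicalEuler hγ isOpen_Ioo) h.sound_init h.velocity_init) (not_le.2 htC)
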